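/- Let ${\mathbf v}_0=(1,0)$, ${\mathbf v}_1=(-\frac12,\frac{\sqrt3}2)$, ${\mathbf v}_2=(-\frac12,-\frac{\sqrt3}2)$, with subscripts read modulo $3$, and let $2\Lambda=\langle 2{\mathbf v}_0,2{\mathbf v}_1,2{\mathbf v}_2\rangle\subset\mathbb R^2$. Let $R=\{-s{\mathbf v}_1-t{\mathbf v}_2: 0\le s,t\le 1\}$ be the closed rhombus with its four vertices removed, and label its edges $1$ ($t=0$), $2$ ($s=1$), $3$ ($t=1$), $4$ ($s=0$). Let $S$ be the translation surface obtained from copies $R^i_{\mathbf c}$ of $R$, $i\in\{0,1,2\}$, ${\mathbf c}\in 2\Lambda$, by gluing, by translations, edge $2$ of $R^i_{\mathbf c}$ to edge $4$ of $R^{i+1}_{{\mathbf c}+2{\mathbf v}_i}$ and edge $3$ of $R^i_{\mathbf c}$ to edge $1$ of $R^{i-1}_{{\mathbf c}+2{\mathbf v}_i}$. Let $Z^\circ=S/2\Lambda$ be the quotient by the action in which ${\mathbf w}\in2\Lambda$ carries $R^i_{\mathbf c}$ to $R^i_{{\mathbf c}+{\mathbf w}}$; it is a torus with three punctures, made of three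 rhombi $R^0,R^1,R^2$. For a connected translation surface $X$, let $V(X)\subset \mathrm{GL}(2,\mathbb R)$ be its Veech group, that is, the group of derivatives of the homeomorphisms $X\to X$ which in local translation charts have the form ${\mathbf x}\mapsto M{\mathbf x}+{\mathbf b}$ with one matrix $M\in\mathrm{GL}(2,\mathbb R)$ (the derivative) and with ${\mathbf b}$ depending on the charts. Let $\mathbb Z^2_{\mathit{vis}}$ be the set of nonzero $(m,n)\in\mathbb Z^2$ with $\gcd(m,n)=1$, and let $\Xi=\{(m,n)\in\mathbb Z^2_{\mathit{vis}}: m\equiv n\pmod 3\}$. **Theorem.** When linear maps are written as matrices in the basis $\{{\mathbf v}_1,{\mathbf v}_2\}$, both $V(Z^\circ)$ and $V(S)$ are equal to $\{M\in\mathrm{GL}(2,\mathbb Z): M(\Xi)=\Xi\}$. Moreover, these groups act transitively on $\Xi$ and on $\mathbb Z^2_{\mathit{vis}}\smallsetminus\Xi$. -/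

import Mathlib

open Set Topology

noncomputable section

/-! ### Translation surfaces and their Veech groups -/

/-- The plane `ℝ²`. -/
abbrev Plane : Type := Fin 2 → ℝ

/-- A translation surface: a space with an atlas of charts to the plane all of whose transition
functions are, locally, translations. -/
class TranslationSurface (X : Type) [TopologicalSpace X] extends ChartedSpace Plane X where
  transition : ∀ e ∈ ChartedSpace.atlas (H := Plane) (M := X),
    ∀ e' ∈ ChartedSpace.atlas (H := Plane) (M := X), ∀ x ∈ (e.symm.trans e').source,
      ∃ c : Plane, ∀ᶠ y in 𝓝 x, (e.symm.trans e') y = y + c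

/-- The homeomorphism `f` of the translation surface `X` is an affine automorphism with derivative
`M`: in local coordinates of the atlas it has the form `x ↦ M x + c`, where the vector `c` depends
on the charts and the matrix `M` does not. -/
def IsAffineAut {X : Type} [TopologicalSpace X] [TranslationSurface X]
    (f : X ≃ₜ X) (M : GL (Fin 2) ℝ) : Prop :=
  ∀ e ∈ atlas Plane X, ∀ e' ∈ atlas Plane X, ∀ p ∈ e.source, f p ∈ e'.source →
    ∃ c : Plane, ∀ᶠ q in 𝓝 p, e' (f q) = M.val.mulVec (e q) + c

/-- The Veech group: the group of derivatives of affine automorphisms. -/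
def veechGroup (X : Type) [TopologicalSpace X] [TranslationSurface X] :
    Subgroup (GL (Fin 2) ℝ) where
  carrier := {M | ∃ f : X ≃ₜ X, IsAffineAut f M}
  one_mem' := by
    refine ⟨Homeomorph.refl X, fun e he e' he' p hp hp' => ?_⟩
    obtain ⟨c, hc⟩ := TranslationSurface.transition e he e' he' (e p)
      (by simp [hp, e.left_inv hp]; exact hp')
    refine ⟨c, ?_⟩
    filter_upwards [(e.continuousAt hp).eventually hc, e.open_source.mem_nhds hp] with q hq hqs
    simpa [e.left_inv hqs] using hq
  mul_mem' := by
    rintro M N ⟨f, hf⟩ ⟨g, hg⟩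
    refine ⟨g.trans f, fun e he e' he' p hp hp' => ?_⟩
    obtain ⟨c, hc⟩ := hg e he (chartAt Plane (g p)) (chart_mem_atlas _ _) p hp
      (mem_chart_source _ _)
    obtain ⟨d, hd⟩ := hf (chartAt Plane (g p)) (chart_mem_atlas _ _) e' he' (g p)
      (mem_chart_source _ _) hp'
    refine ⟨M.val.mulVec c + d, ?_⟩
    filter_upwards [hc, (g.continuous.continuousAt (x := p)).eventually hd] with q hq hq'
    change e' (f (g q)) = _
    rw [hq', hq, Matrix.mulVec_add, Matrix.mulVec_mulVec, Units.val_mul, add_assoc]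
  inv_mem' := by
    rintro M ⟨f, hf⟩
    refine ⟨f.symm, fun e he e' he' p hp hp' => ?_⟩
    obtain ⟨c, hc⟩ := hf e' he' e he (f.symm p) hp' (by simpa using hp)
    refine ⟨-((M⁻¹).val.mulVec c), ?_⟩
    filter_upwards [(f.symm.continuous.continuousAt (x := p)).eventually hc] with q hq
    rw [f.apply_symm_apply] at hq
    have hM : (M⁻¹).val * M.val = 1 := by
      rw [← Units.val_mul, inv_mul_cancel, Units.val_one]
    rw [hq, Matrix.mulVec_add, Matrix.mulVec_mulVec, hM, Matrix.one_mulVec]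
    abel

/-! ### The Eisenstein lattice -/

/-- The vectors `v₀ = (1, 0)`, `v₁ = (-1/2, √3/2)`, `v₂ = (-1/2, -√3/2)`. Subscripts are read
modulo three, as arithmetic in `Fin 3` is. -/
def eisVec : Fin 3 → Plane :=
  ![![1, 0], ![-1 / 2, Real.sqrt 3 / 2], ![-1 / 2, -(Real.sqrt 3 / 2)]]

/-- The lattice `2Λ = ⟨2v₀, 2v₁, 2v₂⟩`, the set of centers of the hexagons of the tiling. -/
def twoLambda : AddSubgroup Plane :=
  AddSubgroup.closure (Set.range fun i => (2 : ℝ) • eisVec i)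

/-- The element `2vᵢ` of `2Λ`. -/
def twoVec (i : Fin 3) : twoLambda :=
  ⟨(2 : ℝ) • eisVec i, AddSubgroup.subset_closure ⟨i, rfl⟩⟩

/-! ### Surfaces glued from copies of one rhombus

The rhombus is `R = {-(s v₁) - t v₂ : 0 ≤ s, t ≤ 1}`, and its edges are, counterclockwise from the
vertex `0`, edge 1 (`t = 0`), edge 2 (`s = 1`), edge 3 (`t = 1`) and edge 4 (`s = 0`). Opposite
edges are parallel, so that edge 2 of a copy can be glued to edge 4 of a copy by a translation, and
edge 3 to edge 1. -/

/-- The point `-(s v₁) - t v₂` of the plane with coordinates `(s, t)`. -/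
def rhombusPoint : ℝ × ℝ ≃ₜ Plane where
  toFun x := -(x.1 • eisVec 1) - x.2 • eisVec 2
  invFun y := (y 0 - y 1 / Real.sqrt 3, y 0 + y 1 / Real.sqrt 3)
  left_inv x := by
    have h : Real.sqrt 3 ≠ 0 := by positivity
    ext <;> simp [eisVec] <;> field_simp <;> ring
  right_inv y := by
    have h : Real.sqrt 3 ≠ 0 := by positivity
    ext i
    fin_cases i <;> simp [eisVec] <;> field_simp <;> ring
  continuous_toFun := by fun_prop
  continuous_invFun := by fun_prop

/-- The closed rhombus without its four vertices, in the coordinates `(s, t)`. -/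
def Tile : Set (ℝ × ℝ) := (Icc 0 1 ×ˢ Icc 0 1) \ ({0, 1} ×ˢ {0, 1})

/-- Gluing data on copies of the rhombus indexed by `I`: edge 2 of the copy `i` is glued to edge 4
of the copy `right i`, and edge 3 of the copy `i` is glued to edge 1 of the copy `up i`. -/
structure Gluing (I : Type) where
  right : Equiv.Perm I
  up : Equiv.Perm I

namespace Gluing

variable {I : Type} (G : Gluing I)

theorem tile_of_fst {s t : ℝ} (h0 : 0 ≤ s) (h1 : s ≤ 1) (ht : t ∈ Ioo (0 : ℝ) 1) :
    (s, t) ∈ Tile := by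
  refine ⟨⟨⟨h0, h1⟩, ht.1.le, ht.2.le⟩, ?_⟩
  rintro ⟨-, h | h⟩
  · exact ht.1.ne' h
  · exact ht.2.ne h

theorem tile_of_snd {s t : ℝ} (hs : s ∈ Ioo (0 : ℝ) 1) (h0 : 0 ≤ t) (h1 : t ≤ 1) :
    (s, t) ∈ Tile := by
  refine ⟨⟨⟨hs.1.le, hs.2.le⟩, h0, h1⟩, ?_⟩
  rintro ⟨h | h, -⟩
  · exact hs.1.ne' h
  · exact hs.2.ne h

/-- The identifications of points of edges. -/
inductive Rel : (Σ _ : I, Tile) → (Σ _ : I, Tile) → Prop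
  | right (i : I) (t : ℝ) (ht : t ∈ Ioo (0 : ℝ) 1) :
      Rel ⟨i, (1, t), tile_of_fst zero_le_one le_rfl ht⟩
        ⟨G.right i, (0, t), tile_of_fst le_rfl zero_le_one ht⟩
  | up (i : I) (s : ℝ) (hs : s ∈ Ioo (0 : ℝ) 1) :
      Rel ⟨i, (s, 1), tile_of_snd hs zero_le_one le_rfl⟩
        ⟨G.up i, (s, 0), tile_of_snd hs le_rfl zero_le_one⟩

/-- The glued surface, with the quotient topology of the disjoint union of the copies. -/
def Surface : Type := Quot G.Rel

instance : TopologicalSpace G.Surface := inferInstanceAs (TopologicalSpace (Quot G.Rel))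

/-- The point of the surface represented by the point `x` of the copy `i`. -/
def pt (i : I) (x : Tile) : G.Surface := Quot.mk _ ⟨i, x⟩

theorem continuous_pt (i : I) : Continuous (G.pt i) :=
  continuous_quot_mk.comp continuous_sigmaMk

theorem pt_right (i : I) (t : ℝ) (ht : t ∈ Ioo (0 : ℝ) 1) :
    G.pt i ⟨(1, t), tile_of_fst zero_le_one le_rfl ht⟩ =
      G.pt (G.right i) ⟨(0, t), tile_of_fst le_rfl zero_le_one ht⟩ :=
  Quot.sound (Rel.right i t ht)

theorem pt_up (i : I) (s : ℝ) (hs : s ∈ Ioo (0 : ℝ) 1) :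
    G.pt i ⟨(s, 1), tile_of_snd hs zero_le_one le_rfl⟩ =
      G.pt (G.up i) ⟨(s, 0), tile_of_snd hs le_rfl zero_le_one⟩ :=
  Quot.sound (Rel.up i s hs)

/-- A criterion for an open embedding of an open set of coordinates into the surface, in terms of
the relation `r p d`, "`p` represents the image of `d`". -/
theorem isOpenEmbedding_of_rep {D : Set (ℝ × ℝ)} (g : D → G.Surface) (hg : Continuous g)
    (r : (Σ _ : I, Tile) → D → Prop)
    (hr : ∀ p q, G.Rel p q → ∀ d, (r p d ↔ r q d))
    (hrg : ∀ p d, r p d → Quot.mk _ p = g d)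
    (hex : ∀ d, ∃ p, r p d ∧ ∀ d', r p d' → d' = d)
    (hop : ∀ W : Set D, IsOpen W → ∀ i, IsOpen {x : Tile | ∃ d ∈ W, r ⟨i, x⟩ d}) :
    IsOpenEmbedding g := by
  let R : G.Surface → D → Prop := Quot.lift r fun p q h => funext fun d => propext (hr p q h d)
  have hR : ∀ d, R (g d) d := by
    intro d
    obtain ⟨p, hp, -⟩ := hex d
    rw [← hrg p d hp]
    exact hp
  have hinj : Function.Injective g := by
    intro d d' h
    obtain ⟨p, hp, hu⟩ := hex d
    refine (hu d' ?_).symm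
    have := hR d'
    rw [← h, ← hrg p d hp] at this
    exact this
  refine IsOpenEmbedding.of_continuous_injective_isOpenMap hg hinj fun W hW => ?_
  have hpre : IsOpen ((Quot.mk G.Rel) ⁻¹' (g '' W)) := by
    rw [isOpen_sigma_iff]
    intro i
    convert hop W hW i using 1
    ext x
    constructor
    · rintro ⟨d, hd, h⟩
      refine ⟨d, hd, ?_⟩
      have := hR d
      rw [h] at this
      exact this
    · rintro ⟨d, hd, h⟩
      exact ⟨d, hd, (hrg _ _ h).symm⟩
  exact isQuotientMap_quot_mk.isOpen_preimage.1 hpre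

/-- A unit square of coordinates that straddles the edge 2 (`s = 1`). -/
def rightDom (a : ℝ) : Set (ℝ × ℝ) := Ioo a (a + 1) ×ˢ Ioo 0 1

/-- A unit square of coordinates that straddles the edge 3 (`t = 1`). -/
def upDom (a : ℝ) : Set (ℝ × ℝ) := Ioo 0 1 ×ˢ Ioo a (a + 1)

theorem isOpen_rightDom (a : ℝ) : IsOpen (rightDom a) := isOpen_Ioo.prod isOpen_Ioo

theorem isOpen_upDom (a : ℝ) : IsOpen (upDom a) := isOpen_Ioo.prod isOpen_Ioo

/-- The inverse of the chart around the edge 2 of the copy `i`: the part `s ≤ 1` lies in the copy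
`i`, and the part `s ≥ 1` in the copy `right i`. -/
def rightMap (a : Ioo (0 : ℝ) 1) (i : I) (d : rightDom a) : G.Surface :=
  if d.1.1 ≤ 1 then
    G.pt i ⟨(min d.1.1 1, d.1.2),
      tile_of_fst (le_min (a.2.1.trans d.2.1.1).le zero_le_one) (min_le_right _ _) d.2.2⟩
  else
    G.pt (G.right i) ⟨(max (d.1.1 - 1) 0, d.1.2),
      tile_of_fst (le_max_right _ _)
        (max_le (by have := d.2.1.2; have := a.2.2; linarith) zero_le_one) d.2.2⟩

/-- The inverse of the chart around the edge 3 of the copy `i`. -/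
def upMap (a : Ioo (0 : ℝ) 1) (i : I) (d : upDom a) : G.Surface :=
  if d.1.2 ≤ 1 then
    G.pt i ⟨(d.1.1, min d.1.2 1),
      tile_of_snd d.2.1 (le_min (a.2.1.trans d.2.2.1).le zero_le_one) (min_le_right _ _)⟩
  else
    G.pt (G.up i) ⟨(d.1.1, max (d.1.2 - 1) 0),
      tile_of_snd d.2.1 (le_max_right _ _)
        (max_le (by have := d.2.2.2; have := a.2.2; linarith) zero_le_one)⟩

theorem isOpen_rep {D : Set (ℝ × ℝ)} (hD : IsOpen D) (j k i : I) (e : ℝ × ℝ) (W : Set D)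
    (hW : IsOpen W) :
    IsOpen {x : Tile | ∃ d ∈ W, (i = j ∧ x.1 = d.1) ∨ (i = k ∧ x.1 + e = d.1)} := by
  have hW' : IsOpen ((↑) '' W : Set (ℝ × ℝ)) := hD.isOpenMap_subtype_val W hW
  have h : {x : Tile | ∃ d ∈ W, (i = j ∧ x.1 = d.1) ∨ (i = k ∧ x.1 + e = d.1)} =
      {x : Tile | i = j ∧ x.1 ∈ ((↑) '' W : Set (ℝ × ℝ))} ∪
        {x : Tile | i = k ∧ x.1 + e ∈ ((↑) '' W : Set (ℝ × ℝ))} := by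
    ext x
    simp only [mem_ofPred_eq, mem_union, mem_image]
    grind
  rw [h]
  exact (isOpen_const.and (hW'.preimage continuous_subtype_val)).union
    (isOpen_const.and (hW'.preimage (continuous_subtype_val.add continuous_const)))

theorem rightMap_isOpenEmbedding (a : Ioo (0 : ℝ) 1) (i : I) :
    IsOpenEmbedding (G.rightMap a i) := by
  obtain ⟨a, ha0, ha1⟩ := a
  refine G.isOpenEmbedding_of_rep _ ?_
    (fun p d => (p.1 = i ∧ p.2.1 = d.1) ∨ (p.1 = G.right i ∧ p.2.1 + (1, 0) = d.1))
    ?_ ?_ ?_ (fun W hW j => isOpen_rep (isOpen_rightDom a) i (G.right i) j (1, 0) W hW)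
  · refine Continuous.if_le ((G.continuous_pt _).comp (by fun_prop))
      ((G.continuous_pt _).comp (by fun_prop)) (by fun_prop) continuous_const ?_
    rintro ⟨⟨s, t⟩, hs, ht⟩ (rfl : s = 1)
    simpa using G.pt_right i t ht
  · rintro p q (⟨j, t, ht⟩ | ⟨j, s, hs⟩) ⟨⟨x, y⟩, ⟨hx0, hx1⟩, hy0, hy1⟩
    · simp only [Prod.mk_add_mk, Prod.mk.injEq, EmbeddingLike.apply_eq_iff_eq] at *
      constructor
      · rintro (⟨rfl, h1, h2⟩ | ⟨-, h1, -⟩)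
        · exact Or.inr ⟨rfl, by linarith, by linarith⟩
        · linarith
      · rintro (⟨-, h1, -⟩ | ⟨rfl, h1, h2⟩)
        · linarith
        · exact Or.inl ⟨rfl, by linarith, by linarith⟩
    · simp only [Prod.mk_add_mk, Prod.mk.injEq] at *
      constructor <;> rintro (⟨-, -, h⟩ | ⟨-, -, h⟩) <;> linarith
  · rintro ⟨j, ⟨s, t⟩, hst⟩ ⟨⟨x, y⟩, ⟨hx0, hx1⟩, hy⟩ h
    simp only [Prod.mk_add_mk, Prod.mk.injEq] at *
    have hs0 := hst.1.1.1
    have hs1 := hst.1.1.2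
    simp only at hs0 hs1
    rcases h with ⟨rfl, rfl, rfl⟩ | ⟨rfl, rfl, h⟩
    · change G.pt _ _ = _
      simp [rightMap, hs1]
    · obtain rfl : t = y := by linarith
      rcases hs0.eq_or_lt with rfl | hs
      · change G.pt _ _ = _
        simpa [rightMap] using (G.pt_right i t hy).symm
      · change G.pt _ _ = _
        simp [rightMap, hs.not_ge, hs.le]
  · rintro ⟨⟨x, y⟩, ⟨hx0, hx1⟩, hy⟩
    simp only at hx0 hx1 hy
    by_cases hx : x ≤ 1
    · refine ⟨⟨i, (x, y), tile_of_fst (ha0.trans hx0).le hx hy⟩, Or.inl ⟨rfl, rfl⟩, ?_⟩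
      rintro ⟨⟨x', y'⟩, ⟨hx0', hx1'⟩, hy'⟩ (⟨-, h⟩ | ⟨-, h⟩)
      · exact Subtype.ext h.symm
      · simp only [Prod.mk_add_mk, Prod.mk.injEq] at *
        linarith
    · push Not at hx
      refine ⟨⟨G.right i, (x - 1, y), tile_of_fst (by linarith) (by linarith) hy⟩,
        Or.inr ⟨rfl, by simp⟩, ?_⟩
      rintro ⟨⟨x', y'⟩, ⟨hx0', hx1'⟩, hy'⟩ (⟨-, h⟩ | ⟨-, h⟩)
      · simp only [Prod.mk.injEq] at *
        linarith
      · refine Subtype.ext ?_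
        rw [← h]
        simp

theorem upMap_isOpenEmbedding (a : Ioo (0 : ℝ) 1) (i : I) :
    IsOpenEmbedding (G.upMap a i) := by
  obtain ⟨a, ha0, ha1⟩ := a
  refine G.isOpenEmbedding_of_rep _ ?_
    (fun p d => (p.1 = i ∧ p.2.1 = d.1) ∨ (p.1 = G.up i ∧ p.2.1 + (0, 1) = d.1))
    ?_ ?_ ?_ (fun W hW j => isOpen_rep (isOpen_upDom a) i (G.up i) j (0, 1) W hW)
  · refine Continuous.if_le ((G.continuous_pt _).comp (by fun_prop))
      ((G.continuous_pt _).comp (by fun_prop)) (by fun_prop) continuous_const ?_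
    rintro ⟨⟨s, t⟩, hs, ht⟩ (rfl : t = 1)
    simpa using G.pt_up i s hs
  · rintro p q (⟨j, t, ht⟩ | ⟨j, s, hs⟩) ⟨⟨x, y⟩, ⟨hx0, hx1⟩, hy0, hy1⟩
    · simp only [Prod.mk_add_mk, Prod.mk.injEq] at *
      constructor <;> rintro (⟨-, h, -⟩ | ⟨-, h, -⟩) <;> linarith
    · simp only [Prod.mk_add_mk, Prod.mk.injEq, EmbeddingLike.apply_eq_iff_eq] at *
      constructor
      · rintro (⟨rfl, h1, h2⟩ | ⟨-, -, h1⟩)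
        · exact Or.inr ⟨rfl, by linarith, by linarith⟩
        · linarith
      · rintro (⟨-, -, h1⟩ | ⟨rfl, h1, h2⟩)
        · linarith
        · exact Or.inl ⟨rfl, by linarith, by linarith⟩
  · rintro ⟨j, ⟨s, t⟩, hst⟩ ⟨⟨x, y⟩, hx, ⟨hy0, hy1⟩⟩ h
    simp only [Prod.mk_add_mk, Prod.mk.injEq] at *
    have ht0 := hst.1.2.1
    have ht1 := hst.1.2.2
    simp only at ht0 ht1
    rcases h with ⟨rfl, rfl, rfl⟩ | ⟨rfl, h, rfl⟩
    · change G.pt _ _ = _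
      simp [upMap, ht1]
    · obtain rfl : s = x := by linarith
      rcases ht0.eq_or_lt with rfl | ht
      · change G.pt _ _ = _
        simpa [upMap] using (G.pt_up i s hx).symm
      · change G.pt _ _ = _
        simp [upMap, ht.not_ge, ht.le]
  · rintro ⟨⟨x, y⟩, hx, ⟨hy0, hy1⟩⟩
    simp only at hy0 hy1 hx
    by_cases hy : y ≤ 1
    · refine ⟨⟨i, (x, y), tile_of_snd hx (ha0.trans hy0).le hy⟩, Or.inl ⟨rfl, rfl⟩, ?_⟩
      rintro ⟨⟨x', y'⟩, hx', ⟨hy0', hy1'⟩⟩ (⟨-, h⟩ | ⟨-, h⟩)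
      · exact Subtype.ext h.symm
      · simp only [Prod.mk_add_mk, Prod.mk.injEq] at *
        linarith
    · push Not at hy
      refine ⟨⟨G.up i, (x, y - 1), tile_of_snd hx (by linarith) (by linarith)⟩,
        Or.inr ⟨rfl, by simp⟩, ?_⟩
      rintro ⟨⟨x', y'⟩, hx', ⟨hy0', hy1'⟩⟩ (⟨-, h⟩ | ⟨-, h⟩)
      · simp only [Prod.mk.injEq] at *
        linarith
      · refine Subtype.ext ?_
        rw [← h]
        simp

/-- The chart with inverse `g`, followed by the passage from the coordinates `(s, t)` to the
point `-(s v₁) - t v₂` of the plane. -/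
def chartOf {D : Set (ℝ × ℝ)} (hD : IsOpen D) (hne : D.Nonempty) (g : D → G.Surface)
    (hg : IsOpenEmbedding g) : OpenPartialHomeomorph G.Surface Plane :=
  haveI : Nonempty D := hne.to_subtype
  ((hg.toOpenPartialHomeomorph g).symm.trans
    (hD.isOpenEmbedding_subtypeVal.toOpenPartialHomeomorph ((↑) : D → ℝ × ℝ))).transHomeomorph
      rhombusPoint

theorem chartOf_source {D : Set (ℝ × ℝ)} (hD : IsOpen D) (hne : D.Nonempty) (g : D → G.Surface)
    (hg : IsOpenEmbedding g) : (G.chartOf hD hne g hg).source = range g := by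
  simp [chartOf]

theorem chartOf_apply {D : Set (ℝ × ℝ)} (hD : IsOpen D) (hne : D.Nonempty) (g : D → G.Surface)
    (hg : IsOpenEmbedding g) (d : D) : G.chartOf hD hne g hg (g d) = rhombusPoint d.1 := by
  have : Nonempty D := hne.to_subtype
  have h : (hg.toOpenPartialHomeomorph g).symm (g d) = d :=
    (hg.toOpenPartialHomeomorph g).left_inv (x := d) (by simp)
  simp [chartOf, h]

theorem rightDom_nonempty (a : ℝ) : (rightDom a).Nonempty :=
  ⟨(a + 1 / 2, 1 / 2), by constructor <;> constructor <;> norm_num⟩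

theorem upDom_nonempty (a : ℝ) : (upDom a).Nonempty :=
  ⟨(1 / 2, a + 1 / 2), by constructor <;> constructor <;> norm_num⟩

/-- The chart around the edge 2 of the copy `i`. -/
def rightChart (a : Ioo (0 : ℝ) 1) (i : I) : OpenPartialHomeomorph G.Surface Plane :=
  G.chartOf (isOpen_rightDom a) (rightDom_nonempty a) _ (G.rightMap_isOpenEmbedding a i)

/-- The chart around the edge 3 of the copy `i`. -/
def upChart (a : Ioo (0 : ℝ) 1) (i : I) : OpenPartialHomeomorph G.Surface Plane :=
  G.chartOf (isOpen_upDom a) (upDom_nonempty a) _ (G.upMap_isOpenEmbedding a i)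

/-- The charts around the edges; together they contain the interiors of the rhombi as well. -/
def charts : Set (OpenPartialHomeomorph G.Surface Plane) :=
  {e | ∃ a i, e = G.rightChart a i ∨ e = G.upChart a i}

/-- The number `1/2` of the interval `(0, 1)`. -/
def half : Ioo (0 : ℝ) 1 := ⟨1 / 2, mem_Ioo.2 ⟨by norm_num, by norm_num⟩⟩

theorem exists_chart (p : G.Surface) : ∃ e ∈ G.charts, p ∈ e.source := by
  induction p using Quot.ind with
  | mk p =>
    obtain ⟨i, ⟨s, t⟩, ⟨⟨hs0, hs1⟩, ht0, ht1⟩, hst⟩ := p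
    simp only at hs0 hs1 ht0 ht1
    by_cases ht : t ∈ Ioo (0 : ℝ) 1
    · rcases hs0.eq_or_lt with rfl | hs
      · refine ⟨_, ⟨half, G.right.symm i, Or.inl rfl⟩, ?_⟩
        rw [rightChart, chartOf_source]
        refine ⟨⟨(1, t), ⟨by norm_num [half], by norm_num [half]⟩, ht⟩, ?_⟩
        change _ = G.pt _ _
        simpa [rightMap] using G.pt_right (G.right.symm i) t ht
      · refine ⟨_, ⟨⟨s / 2, mem_Ioo.2 ⟨by linarith, by linarith⟩⟩, i, Or.inl rfl⟩, ?_⟩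
        rw [rightChart, chartOf_source]
        refine ⟨⟨(s, t), ⟨by simp only; linarith, by simp only; linarith⟩, ht⟩, ?_⟩
        change _ = G.pt _ _
        simp [rightMap, hs1]
    · have ht' : t = 0 ∨ t = 1 := by
        rcases ht0.eq_or_lt with h | h
        · exact Or.inl h.symm
        · exact Or.inr (le_antisymm ht1 (not_lt.1 fun h' => ht ⟨h, h'⟩))
      have hs : s ∈ Ioo (0 : ℝ) 1 := by
        refine ⟨lt_of_le_of_ne hs0 fun h => hst ?_, lt_of_le_of_ne hs1 fun h => hst ?_⟩
        · exact ⟨Or.inl h.symm, ht'⟩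
        · exact ⟨Or.inr h, ht'⟩
      rcases ht' with rfl | rfl
      · refine ⟨_, ⟨half, G.up.symm i, Or.inr rfl⟩, ?_⟩
        rw [upChart, chartOf_source]
        refine ⟨⟨(s, 1), hs, ⟨by norm_num [half], by norm_num [half]⟩⟩, ?_⟩
        change _ = G.pt _ _
        simpa [upMap] using G.pt_up (G.up.symm i) s hs
      · refine ⟨_, ⟨half, i, Or.inr rfl⟩, ?_⟩
        rw [upChart, chartOf_source]
        refine ⟨⟨(s, 1), hs, ⟨by norm_num [half], by norm_num [half]⟩⟩, ?_⟩
        change _ = G.pt _ _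
        simp [upMap]

/-- The map to the torus `ℝ²/ℤ²` given by the coordinates `(s, t)`. -/
def toTorus : G.Surface → UnitAddCircle × UnitAddCircle :=
  Quot.lift (fun p => ((p.2.1.1 : UnitAddCircle), (p.2.1.2 : UnitAddCircle))) (by
    rintro p q (⟨j, t, ht⟩ | ⟨j, s, hs⟩) <;> simp)

theorem toTorus_chart {e : OpenPartialHomeomorph G.Surface Plane} (he : e ∈ G.charts)
    {p : G.Surface} (hp : p ∈ e.source) :
    G.toTorus p = (((rhombusPoint.symm (e p)).1 : UnitAddCircle),
      ((rhombusPoint.symm (e p)).2 : UnitAddCircle)) := by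
  obtain ⟨⟨a, ha⟩, i, rfl | rfl⟩ := he
  · rw [rightChart, chartOf_source] at hp
    obtain ⟨⟨⟨x, y⟩, ⟨hx0, hx1⟩, hy⟩, rfl⟩ := hp
    rw [rightChart, chartOf_apply, rhombusPoint.symm_apply_apply]
    simp only at hx0 hx1
    by_cases hx : x ≤ 1
    · simp [rightMap, pt, toTorus, hx]
    · have : 0 ≤ x - 1 := by linarith
      simp [rightMap, pt, toTorus, hx, max_eq_left this]
  · rw [upChart, chartOf_source] at hp
    obtain ⟨⟨⟨x, y⟩, hx, ⟨hy0, hy1⟩⟩, rfl⟩ := hp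
    rw [upChart, chartOf_apply, rhombusPoint.symm_apply_apply]
    simp only at hy0 hy1
    by_cases hy : y ≤ 1
    · simp [upMap, pt, toTorus, hy]
    · have : 0 ≤ y - 1 := by linarith
      simp [upMap, pt, toTorus, hy, max_eq_left this]

theorem eventually_const_of_int {f : Plane → ℝ} {x : Plane} (hf : ContinuousAt f x)
    (hZ : ∀ᶠ y in 𝓝 x, ∃ n : ℤ, f y = n) : ∀ᶠ y in 𝓝 x, f y = f x := by
  obtain ⟨m, hm⟩ := hZ.self_of_nhds
  have h1 : ∀ᶠ y in 𝓝 x, |f y - f x| < 1 := by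
    have := hf.eventually (Metric.ball_mem_nhds (f x) one_pos)
    simpa [Real.dist_eq] using this
  filter_upwards [hZ, h1] with y ⟨n, hn⟩ hy
  rw [hn, hm] at hy ⊢
  have : |n - m| < 1 := by exact_mod_cast hy
  have : n = m := by
    have := Int.abs_lt_one_iff.1 this
    omega
  rw [this]

theorem exists_int_of_coe_eq {x y : ℝ} (h : (x : UnitAddCircle) = (y : UnitAddCircle)) :
    ∃ n : ℤ, x - y = n := by
  have : ((x - y : ℝ) : UnitAddCircle) = 0 := by
    rw [AddCircle.coe_sub, h, sub_self]
  obtain ⟨n, hn⟩ := (AddCircle.coe_eq_zero_iff (1 : ℝ)).1 this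
  exact ⟨n, by simpa using hn.symm⟩

instance : TranslationSurface G.Surface where
  atlas := G.charts
  chartAt p := (G.exists_chart p).choose
  mem_chart_source p := (G.exists_chart p).choose_spec.2
  chart_mem_atlas p := (G.exists_chart p).choose_spec.1
  transition e he e' he' x hx := by
    set τ := e.symm.trans e' with hτ
    have hZ : ∀ y ∈ τ.source,
        (∃ n : ℤ, (rhombusPoint.symm (τ y)).1 - (rhombusPoint.symm y).1 = n) ∧
        (∃ n : ℤ, (rhombusPoint.symm (τ y)).2 - (rhombusPoint.symm y).2 = n) := by
      intro y hy
      rw [hτ, OpenPartialHomeomorph.trans_source] at hy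
      have hy1 : y ∈ e.target := hy.1
      have h1 := G.toTorus_chart he (e.map_target hy1)
      have h2 := G.toTorus_chart he' (show e.symm y ∈ e'.source from hy.2)
      rw [e.right_inv hy1] at h1
      rw [h1, Prod.mk.injEq] at h2
      exact ⟨exists_int_of_coe_eq h2.1.symm, exists_int_of_coe_eq h2.2.symm⟩
    have hc : ContinuousAt τ x := τ.continuousAt hx
    have hev : ∀ᶠ y in 𝓝 x, y ∈ τ.source := τ.open_source.mem_nhds hx
    have hcs : ContinuousAt (fun y => rhombusPoint.symm (τ y)) x :=
      rhombusPoint.symm.continuous.continuousAt.comp hc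
    have hci : ContinuousAt (fun y => rhombusPoint.symm y) x :=
      rhombusPoint.symm.continuous.continuousAt
    have e1 := eventually_const_of_int (x := x) (hcs.fst.sub hci.fst)
      (hev.mono fun y hy => (hZ y hy).1)
    have e2 := eventually_const_of_int (x := x) (hcs.snd.sub hci.snd)
      (hev.mono fun y hy => (hZ y hy).2)
    refine ⟨τ x - x, ?_⟩
    filter_upwards [e1, e2] with y h1 h2
    simp only [Pi.sub_apply] at h1 h2
    have key : ∀ u : Plane, u = -((rhombusPoint.symm u).1 • eisVec 1)
        - (rhombusPoint.symm u).2 • eisVec 2 := fun u => (rhombusPoint.apply_symm_apply u).symm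
    have h1' : (rhombusPoint.symm (τ y)).1 = (rhombusPoint.symm y).1 +
      ((rhombusPoint.symm (τ x)).1 - (rhombusPoint.symm x).1) := by linarith
    have h2' : (rhombusPoint.symm (τ y)).2 = (rhombusPoint.symm y).2 +
      ((rhombusPoint.symm (τ x)).2 - (rhombusPoint.symm x).2) := by linarith
    rw [key (τ y), h1', h2']
    linear_combination (norm := module) (-1 : ℝ) • key y + (-1 : ℝ) • key (τ x) + key x

end Gluing

/-! ### The surfaces `S` and `Z°` of the trihexagonal tiling -/

/-- The gluing of `S`. The copy `(i, c)`, with `c ∈ 2Λ`, stands for the rhombus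
`Rⁱ_c = {c - s v_{i+1} - t v_{i-1} : 0 ≤ s, t ≤ 1}` of the hexagon with center `c`, rotated to the
standard position by the isometry that respects the coordinates `(s, t)`. Edge 2 of `Rⁱ_c` is glued
to edge 4 of `Rⁱ⁺¹_{c + 2vᵢ}`, and edge 3 of `Rⁱ_c` to edge 1 of `Rⁱ⁻¹_{c + 2vᵢ}`. -/
def gluingS : Gluing (Fin 3 × twoLambda) where
  right :=
    { toFun := fun p => (p.1 + 1, p.2 + twoVec p.1)
      invFun := fun p => (p.1 - 1, p.2 - twoVec (p.1 - 1))
      left_inv := fun p => by simp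
      right_inv := fun p => by simp }
  up :=
    { toFun := fun p => (p.1 - 1, p.2 + twoVec p.1)
      invFun := fun p => (p.1 + 1, p.2 - twoVec (p.1 + 1))
      left_inv := fun p => by simp
      right_inv := fun p => by simp }

/-- The infinite translation surface `S`. -/
abbrev SurfaceS : Type := gluingS.Surface

/-- The gluing of `Z°`: that of `S` with the centers forgotten. -/
def gluingZ : Gluing (Fin 3) where
  right := Equiv.addRight 1
  up := Equiv.subRight 1

/-- The surface `Z° = S/2Λ`, a torus without three points, which consists of three rhombi. -/
abbrev SurfaceZ : Type := gluingZ.Surface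

/-- The action of `w ∈ 2Λ` on `S`, which carries `Rⁱ_c` to `Rⁱ_{c + w}`. -/
def deck (w : twoLambda) : SurfaceS → SurfaceS :=
  Quot.map (fun p => ⟨(p.1.1, p.1.2 + w), p.2⟩) (by
    rintro p q (⟨⟨i, c⟩, t, ht⟩ | ⟨⟨i, c⟩, s, hs⟩)
    · convert Gluing.Rel.right (G := gluingS) (i, c + w) t ht using 1
      simp [gluingS, add_right_comm]
    · convert Gluing.Rel.up (G := gluingS) (i, c + w) s hs using 1
      simp [gluingS, add_right_comm])

/-- The projection `S → Z°`, which carries `Rⁱ_c` to `Rⁱ`. -/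
def projZ : SurfaceS → SurfaceZ :=
  Quot.map (fun p => ⟨p.1.1, p.2⟩) (by
    rintro p q (⟨⟨i, c⟩, t, ht⟩ | ⟨⟨i, c⟩, s, hs⟩)
    · exact Gluing.Rel.right (G := gluingZ) i t ht
    · exact Gluing.Rel.up (G := gluingZ) i s hs)

theorem exists_lift {p q : Σ _ : Fin 3, Tile} (h : Relation.EqvGen gluingZ.Rel p q) :
    ∃ w : twoLambda, ∀ c, gluingS.pt (p.1, c) p.2 = gluingS.pt (q.1, c + w) q.2 := by
  induction h with
  | rel p q h =>
    rcases h with ⟨i, t, ht⟩ | ⟨i, s, hs⟩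
    · exact ⟨twoVec i, fun c => gluingS.pt_right (i, c) t ht⟩
    · exact ⟨twoVec i, fun c => gluingS.pt_up (i, c) s hs⟩
  | refl p => exact ⟨0, fun c => by rw [add_zero]⟩
  | symm p q _ ih =>
    obtain ⟨w, hw⟩ := ih
    exact ⟨-w, fun c => by rw [hw, neg_add_cancel_right]⟩
  | trans p q r _ _ ih ih' =>
    obtain ⟨w, hw⟩ := ih
    obtain ⟨w', hw'⟩ := ih'
    exact ⟨w + w', fun c => by rw [hw, hw', add_assoc]⟩

/-- `Z°` is, as a set, the quotient of `S` by the action of `2Λ`. -/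
theorem projZ_eq_iff (x y : SurfaceS) : projZ x = projZ y ↔ ∃ w, deck w x = y := by
  induction x using Quot.ind with
  | mk p =>
    induction y using Quot.ind with
    | mk q =>
      obtain ⟨⟨i, c⟩, u⟩ := p
      obtain ⟨⟨j, d⟩, u'⟩ := q
      constructor
      · intro h
        obtain ⟨w, hw⟩ := exists_lift (Quot.eqvGen_exact h)
        refine ⟨d - c - w, ?_⟩
        have := hw (c + (d - c - w))
        rw [show c + (d - c - w) + w = d by abel] at this
        exact this
      · rintro ⟨w, hw⟩
        rw [← hw]
        rfl

/-- The topology of `Z°` is the quotient topology. -/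
theorem projZ_isQuotientMap : IsQuotientMap projZ := by
  have hf : Continuous (fun p : Σ _ : Fin 3 × twoLambda, Tile =>
      (⟨p.1.1, p.2⟩ : Σ _ : Fin 3, Tile)) :=
    continuous_sigma fun p => continuous_sigmaMk (σ := fun _ : Fin 3 => Tile) (i := p.1)
  have hs : Continuous (fun p : Σ _ : Fin 3, Tile =>
      (⟨(p.1, 0), p.2⟩ : Σ _ : Fin 3 × twoLambda, Tile)) :=
    continuous_sigma fun i =>
      continuous_sigmaMk (σ := fun _ : Fin 3 × twoLambda => Tile) (i := (i, 0))
  have h1 : IsQuotientMap (fun p : Σ _ : Fin 3 × twoLambda, Tile =>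
      (⟨p.1.1, p.2⟩ : Σ _ : Fin 3, Tile)) :=
    IsQuotientMap.of_comp hs hf IsQuotientMap.id
  have h2 : IsQuotientMap (Quot.mk gluingZ.Rel) := isQuotientMap_quot_mk
  have hc : Continuous projZ := continuous_quot_lift _ (h2.continuous.comp hf)
  exact IsQuotientMap.of_comp (f := Quot.mk gluingS.Rel) continuous_quot_mk hc (h2.comp h1)

/-! ### Matrices -/

/-- The matrix with columns `v₁` and `v₂`. -/
def basisMatrix : GL (Fin 2) ℝ :=
  Matrix.GeneralLinearGroup.mkOfDetNeZero
    !![eisVec 1 0, eisVec 2 0; eisVec 1 1, eisVec 2 1] (by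
      have h : Real.sqrt 3 ≠ 0 := by positivity
      simp [eisVec, Matrix.det_fin_two]
      intro h'
      apply h
      linarith)

/-- The linear map of the plane, as a matrix in the standard basis, which is written as the integer
matrix `M` in the basis `{v₁, v₂}`. -/
def inBasis (M : GL (Fin 2) ℤ) : GL (Fin 2) ℝ :=
  basisMatrix * Matrix.GeneralLinearGroup.map (Int.castRingHom ℝ) M * basisMatrix⁻¹

/-- The pairs of integers that are visible from the origin. -/
def visible : Set (Fin 2 → ℤ) := {w | w ≠ 0 ∧ Int.gcd (w 0) (w 1) = 1}

/-- The visible pairs `(m, n)` with `m ≡ n` modulo 3. -/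
def Xi : Set (Fin 2 → ℤ) := {w | w ∈ visible ∧ w 0 ≡ w 1 [ZMOD 3]}

end

/-!
The coordinates `(s, t)` of the rhombi map every glued surface to the torus `ℝ² / ℤ²` without the
point `0` (`Gluing.toTorus`), and the charts differ from this map by integral translations only.

*Affine automorphisms are lifts of integral matrices.* In each horizontal strip an affine
automorphism `f` has the form `x ↦ P x + b`. If `P c + b` were not a lattice point for some vertex
`c` of the strip, `f` would have a limit there, because the surface covers the punctured torus
(`Gluing.exists_tendsto`); then `f⁻¹` would carry this limit to a limit at the missing vertex. Hence
`P` and `b` are integral, and `f` covers the action of `P` on the torus. Conversely, a homeomorphism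
that covers an integral matrix is affine. So the Veech group is the group `Gluing.lifts` of the
integral matrices that lift to the surface (`Gluing.veechGroup_eq`).

*Lifts.* The exchange of the coordinates, the reflection `s ↦ 1 - s` and the shear `s ↦ s + t` are
homeomorphisms from the surface of the permutations `(r, u)` to those of `(u, r)`, `(r⁻¹, u)` and
`(r, u r⁻¹)`. A product of these matrices therefore lifts to an automorphism as soon as the
resulting pair is simultaneously conjugate to `(r, u)`. For both `S` and `Z°` this yields the
exchange of the coordinates, `-1`, the parabolic matrix `glDiag` that fixes `(1, 1)`, and
`glShear ^ 3`.

*Obstruction.* Whether a line of velocity `w` can close up after time `k` is invariant under lifts.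
Horizontal lines close up after time `k` exactly if `r ^ k` has a fixed point, and diagonal lines
exactly if `(u r) ^ k` has one. For `Z°` with `k = 1` and for `S` with `k = 3` the answers for
`(1, 0)` and `(1, 1)` differ, so no lift carries `(1, 1)` to `(1, 0)`.

*Arithmetic.* By a Euclidean algorithm the four matrices above move each vector of `Ξ` to `(1, 1)`
and every other visible vector to `(1, 0)`. Together with the obstruction and the computation of the
stabilizer of `(1, 1)`, this identifies the group and its orbits (`eq_stabilizer_Xi`).
-/

/-! ### Points of the surface and of the torus -/

/-- The class of a point of the plane in the torus `ℝ² / ℤ²`. -/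
def torusMk (x : ℝ × ℝ) : UnitAddCircle × UnitAddCircle :=
  ((x.1 : UnitAddCircle), (x.2 : UnitAddCircle))

theorem continuous_torusMk : Continuous torusMk :=
  ((AddCircle.continuous_mk' 1).comp continuous_fst).prodMk
    ((AddCircle.continuous_mk' 1).comp continuous_snd)

theorem torusMk_eq_iff {x y : ℝ × ℝ} :
    torusMk x = torusMk y ↔ ∃ m n : ℤ, x = (y.1 + m, y.2 + n) := by
  constructor
  · intro h
    obtain ⟨m, hm⟩ := Gluing.exists_int_of_coe_eq (Prod.mk.inj h).1
    obtain ⟨n, hn⟩ := Gluing.exists_int_of_coe_eq (Prod.mk.inj h).2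
    exact ⟨m, n, Prod.ext (by simp only; linarith) (by simp only; linarith)⟩
  · rintro ⟨m, n, rfl⟩
    simp [torusMk]

theorem torusMk_add (x y : ℝ × ℝ) : torusMk (x + y) = torusMk x + torusMk y := by
  simp [torusMk]

theorem torusMk_eq_zero_iff {x : ℝ × ℝ} : torusMk x = 0 ↔ ∃ m n : ℤ, x = ((m : ℝ), (n : ℝ)) := by
  have h : (0 : UnitAddCircle × UnitAddCircle) = torusMk 0 := rfl
  rw [h, torusMk_eq_iff]
  simp

theorem torusMk_surjective : Function.Surjective torusMk := by
  rintro ⟨a, b⟩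
  obtain ⟨x, rfl⟩ := QuotientAddGroup.mk_surjective a
  obtain ⟨y, rfl⟩ := QuotientAddGroup.mk_surjective b
  exact ⟨(x, y), rfl⟩

theorem mem_tile_iff {x : ℝ × ℝ} :
    x ∈ Tile ↔ x.1 ∈ Icc (0 : ℝ) 1 ∧ x.2 ∈ Icc (0 : ℝ) 1 ∧ torusMk x ≠ 0 := by
  obtain ⟨s, t⟩ := x
  have key : ∀ (y : ℝ), y ∈ Icc (0 : ℝ) 1 → ∀ m : ℤ, y = m → y = 0 ∨ y = 1 := by
    rintro y ⟨h0, h1⟩ m rfl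
    have h0' : 0 ≤ m := by exact_mod_cast h0
    have h1' : m ≤ 1 := by exact_mod_cast h1
    interval_cases m <;> simp
  constructor
  · rintro ⟨⟨hs, ht⟩, h⟩
    refine ⟨hs, ht, fun h0 => h ?_⟩
    obtain ⟨m, n, hmn⟩ := torusMk_eq_zero_iff.1 h0
    rw [Prod.mk.injEq] at hmn
    exact ⟨key s hs m hmn.1, key t ht n hmn.2⟩
  · rintro ⟨hs, ht, h⟩
    refine ⟨⟨hs, ht⟩, fun h0 => h (torusMk_eq_zero_iff.2 ?_)⟩
    obtain ⟨h1 | h1, h2 | h2⟩ := h0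
    · exact ⟨0, 0, by simp_all⟩
    · exact ⟨0, 1, by simp_all⟩
    · exact ⟨1, 0, by simp_all⟩
    · exact ⟨1, 1, by simp_all⟩

theorem torusMk_ne_zero_of_snd {x : ℝ × ℝ} (h : x.2 ∈ Ioo (0 : ℝ) 1) : torusMk x ≠ 0 := by
  intro h0
  obtain ⟨m, n, rfl⟩ := torusMk_eq_zero_iff.1 h0
  have h1 : 0 < n := Int.cast_pos.1 h.1
  have h2 : n < 1 := by exact_mod_cast (show (n : ℝ) < 1 from h.2)
  omega

namespace Gluing

variable {I J : Type} (G : Gluing I)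

theorem continuous_toTorus : Continuous G.toTorus :=
  continuous_quot_lift _ (continuous_sigma fun _ =>
    continuous_torusMk.comp continuous_subtype_val)

theorem toTorus_pt (i : I) (x : Tile) : G.toTorus (G.pt i x) = torusMk x.1 := rfl

theorem exists_pt (p : G.Surface) : ∃ i x, G.pt i x = p := by
  obtain ⟨⟨i, x⟩, rfl⟩ := Quot.exists_rep p
  exact ⟨i, x, rfl⟩

theorem toTorus_ne_zero (p : G.Surface) : G.toTorus p ≠ 0 := by
  obtain ⟨i, x, rfl⟩ := G.exists_pt p
  exact (mem_tile_iff.1 x.2).2.2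

/-- The point of the surface with coordinates `x` in the copy `i`; the center of the copy when
`x` does not lie in the rhombus. -/
noncomputable def point (i : I) (x : ℝ × ℝ) : G.Surface :=
  open Classical in
  G.pt i (if h : x ∈ Tile then ⟨x, h⟩ else
    ⟨(1 / 2, 1 / 2), tile_of_fst (by norm_num) (by norm_num) ⟨by norm_num, by norm_num⟩⟩)

theorem point_of_mem (i : I) {x : ℝ × ℝ} (h : x ∈ Tile) : G.point i x = G.pt i ⟨x, h⟩ := by
  simp [point, h]

theorem point_coe (i : I) (x : Tile) : G.point i x = G.pt i x := G.point_of_mem i x.2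

theorem continuousOn_point (i : I) : ContinuousOn (G.point i) Tile := by
  rw [continuousOn_iff_continuous_domRestrict]
  convert G.continuous_pt i using 1
  ext x
  exact G.point_coe i x

theorem toTorus_point (i : I) {x : ℝ × ℝ} (h : x ∈ Tile) :
    G.toTorus (G.point i x) = torusMk x := by
  rw [point_of_mem G i h, toTorus_pt]

theorem point_right (i : I) {t : ℝ} (ht : t ∈ Ioo (0 : ℝ) 1) :
    G.point i (1, t) = G.point (G.right i) (0, t) := by
  rw [point_of_mem G _ (tile_of_fst zero_le_one le_rfl ht),
    point_of_mem G _ (tile_of_fst le_rfl zero_le_one ht), pt_right _ _ _ ht]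

theorem point_up (i : I) {s : ℝ} (hs : s ∈ Ioo (0 : ℝ) 1) :
    G.point i (s, 1) = G.point (G.up i) (s, 0) := by
  rw [point_of_mem G _ (tile_of_snd hs zero_le_one le_rfl),
    point_of_mem G _ (tile_of_snd hs le_rfl zero_le_one), pt_up _ _ _ hs]

/-- A continuous map out of the surface, from continuous maps on the copies of the rhombus that
respect the gluing. -/
def descend {X : Type*} [TopologicalSpace X] (F : I → Tile → X) (hF : ∀ i, Continuous (F i))
    (hr : ∀ i t (ht : t ∈ Ioo (0 : ℝ) 1), F i ⟨(1, t), tile_of_fst zero_le_one le_rfl ht⟩ =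
      F (G.right i) ⟨(0, t), tile_of_fst le_rfl zero_le_one ht⟩)
    (hu : ∀ i s (hs : s ∈ Ioo (0 : ℝ) 1), F i ⟨(s, 1), tile_of_snd hs zero_le_one le_rfl⟩ =
      F (G.up i) ⟨(s, 0), tile_of_snd hs le_rfl zero_le_one⟩) : C(G.Surface, X) where
  toFun := Quot.lift (fun p => F p.1 p.2) (by
    rintro p q (⟨i, t, ht⟩ | ⟨i, s, hs⟩)
    · exact hr i t ht
    · exact hu i s hs)
  continuous_toFun := continuous_quot_lift _ (continuous_sigma hF)

open Classical in
/-- The copy of the half-open rhombus `0 ≤ s, t < 1` that contains a point, where points on the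
edges 2 and 3 are moved to the opposite edge of the neighboring copy. -/
noncomputable def tileIndex : G.Surface → I :=
  Quot.lift (fun p => if p.2.1.1 = 1 then G.right p.1 else if p.2.1.2 = 1 then G.up p.1 else p.1)
    (by
      rintro p q (⟨i, t, ht⟩ | ⟨i, s, hs⟩)
      · simp [ht.2.ne]
      · simp [hs.2.ne])

theorem tileIndex_point (i : I) {x : ℝ × ℝ} (hx : x ∈ Tile) (h1 : x.1 ≠ 1) (h2 : x.2 ≠ 1) :
    G.tileIndex (G.point i x) = i := by
  rw [point_of_mem G i hx]
  simp [tileIndex, pt, h1, h2]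

/-! ### Horizontal strips -/

/-- The closed strip `0 ≤ t ≤ 1` without the lattice points. -/
def stripDom : Set (ℝ × ℝ) := {x | x.2 ∈ Icc (0 : ℝ) 1 ∧ torusMk x ≠ 0}

/-- The horizontal strip that starts with the copy `i`: the unit square `n ≤ s ≤ n + 1` lies in
the copy `right ^ n i`. -/
noncomputable def strip (i : I) (x : ℝ × ℝ) : G.Surface :=
  G.point ((G.right ^ ⌊x.1⌋) i) (Int.fract x.1, x.2)

theorem mem_stripDom_of_snd {x : ℝ × ℝ} (h : x.2 ∈ Ioo (0 : ℝ) 1) : x ∈ stripDom :=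
  ⟨⟨h.1.le, h.2.le⟩, torusMk_ne_zero_of_snd h⟩

theorem torusMk_sub_int (x : ℝ × ℝ) (n : ℤ) : torusMk (x.1 - n, x.2) = torusMk x :=
  torusMk_eq_iff.2 ⟨-n, 0, by simp [sub_eq_add_neg]⟩

theorem sub_int_mem_tile {x : ℝ × ℝ} (hx : x ∈ stripDom) {n : ℤ} (h0 : n ≤ x.1)
    (h1 : x.1 ≤ n + 1) : (x.1 - n, x.2) ∈ Tile := by
  refine mem_tile_iff.2 ⟨⟨by simpa using h0, by simp only; linarith⟩, hx.1, ?_⟩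
  rw [torusMk_sub_int]
  exact hx.2

theorem fract_mem_tile {x : ℝ × ℝ} (hx : x ∈ stripDom) : (Int.fract x.1, x.2) ∈ Tile :=
  sub_int_mem_tile hx (Int.floor_le _) (Int.lt_floor_add_one _).le

theorem tile_subset_stripDom : Tile ⊆ stripDom := fun _ hx => (mem_tile_iff.1 hx).2

theorem toTorus_strip (i : I) {x : ℝ × ℝ} (hx : x ∈ stripDom) :
    G.toTorus (G.strip i x) = torusMk x := by
  rw [strip, toTorus_point _ _ (fract_mem_tile hx)]
  exact torusMk_sub_int x _

/-- The description of the strip by the copy `right ^ n i` remains valid at the end `s = n + 1` of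
the square, where the floor of `s` jumps. -/
theorem strip_eq_point (i : I) {x : ℝ × ℝ} (hx : x ∈ stripDom) {n : ℤ} (h0 : n ≤ x.1)
    (h1 : x.1 ≤ n + 1) : G.strip i x = G.point ((G.right ^ n) i) (x.1 - n, x.2) := by
  rcases h1.lt_or_eq with h | h
  · have : ⌊x.1⌋ = n := Int.floor_eq_iff.2 ⟨h0, h⟩
    rw [strip, Int.fract, this]
  · have hf : ⌊x.1⌋ = n + 1 := by rw [h]; exact_mod_cast Int.floor_intCast (n + 1)
    have ht : x.2 ∈ Ioo (0 : ℝ) 1 := by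
      have := sub_int_mem_tile hx h0 h1
      rw [h, add_sub_cancel_left] at this
      rcases this with ⟨⟨-, h2, h3⟩, h4⟩
      simp only [mem_prod, mem_insert_iff, mem_singleton_iff, not_and, not_or] at h4 h2 h3
      exact ⟨lt_of_le_of_ne h2 (Ne.symm (h4 (by simp)).1), lt_of_le_of_ne h3 (h4 (by simp)).2⟩
    rw [strip, Int.fract, hf, h]
    push_cast
    rw [sub_self, add_sub_cancel_left, G.point_right _ ht, add_comm n 1, zpow_add, zpow_one]
    rfl

theorem strip_of_mem_tile (i : I) {x : ℝ × ℝ} (hx : x ∈ Tile) : G.strip i x = G.point i x := by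
  have := mem_tile_iff.1 hx
  rw [G.strip_eq_point i (tile_subset_stripDom hx) (n := 0) (by simpa using this.1.1)
    (by simpa using this.1.2)]
  simp

theorem strip_add_int (i : I) (s t : ℝ) (n : ℤ) :
    G.strip i (s + n, t) = G.strip ((G.right ^ n) i) (s, t) := by
  simp [strip, zpow_add]

theorem continuousOn_strip (i : I) : ContinuousOn (G.strip i) stripDom := by
  rw [continuousOn_iff_continuous_domRestrict]
  have hfin : LocallyFinite fun n : ℤ => {x : stripDom | x.1.1 ∈ Icc (n : ℝ) (n + 1)} := by
    intro x
    refine ⟨{y | y.1.1 ∈ Ioo (x.1.1 - 1) (x.1.1 + 1)},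
      (isOpen_Ioo.preimage (by fun_prop)).mem_nhds (by simp), ?_⟩
    refine (Set.finite_Icc (⌊x.1.1⌋ - 3) (⌊x.1.1⌋ + 3)).subset ?_
    rintro n ⟨y, ⟨h1, h2⟩, h3, h4⟩
    have h5 := Int.floor_le x.1.1
    have h6 := Int.lt_floor_add_one x.1.1
    constructor
    · have : ((⌊x.1.1⌋ - 3 : ℤ) : ℝ) ≤ n := by push_cast; linarith
      exact_mod_cast this
    · have : (n : ℝ) ≤ ((⌊x.1.1⌋ + 3 : ℤ) : ℝ) := by push_cast; linarith
      exact_mod_cast this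
  refine hfin.continuous ?_ (fun n => isClosed_Icc.preimage (by fun_prop)) fun n => ?_
  · refine iUnion_eq_univ_iff.2 fun x => ⟨⌊x.1.1⌋, Int.floor_le _, (Int.lt_floor_add_one _).le⟩
  · have h : ContinuousOn (fun x : stripDom => G.point ((G.right ^ n) i) (x.1.1 - n, x.1.2))
        {x : stripDom | x.1.1 ∈ Icc (n : ℝ) (n + 1)} :=
      (G.continuousOn_point _).comp (by fun_prop)
        fun x hx => sub_int_mem_tile x.2 hx.1 hx.2
    exact h.congr fun x hx => G.strip_eq_point i x.2 hx.1 hx.2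

theorem tileIndex_strip (i : I) {x : ℝ × ℝ} (hx : x.2 ∈ Ioo (0 : ℝ) 1) :
    G.tileIndex (G.strip i x) = (G.right ^ ⌊x.1⌋) i :=
  G.tileIndex_point _ (fract_mem_tile (mem_stripDom_of_snd hx)) (Int.fract_lt_one _).ne hx.2.ne

/-- The strips are disjoint sheets. -/
theorem strip_index_injective {i j : I} {x : ℝ × ℝ} (hx : x.2 ∈ Ioo (0 : ℝ) 1)
    (h : G.strip i x = G.strip j x) : i = j := by
  have := congrArg G.tileIndex h
  rwa [tileIndex_strip _ _ hx, tileIndex_strip _ _ hx, EmbeddingLike.apply_eq_iff_eq] at this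

/-- The strips contain all points outside the horizontal edges. -/
theorem exists_strip_eq {p : G.Surface} {x : ℝ × ℝ} (hx : x.2 ∈ Ioo (0 : ℝ) 1)
    (h : G.toTorus p = torusMk x) : ∃ i, G.strip i x = p := by
  obtain ⟨j, y, rfl⟩ := G.exists_pt p
  rw [toTorus_pt] at h
  obtain ⟨m, n, hmn⟩ := torusMk_eq_iff.1 h.symm
  have hy := mem_tile_iff.1 y.2
  have h2 : x.2 = y.1.2 + n := congrArg Prod.snd hmn
  have hn : n = 0 := by
    have h3 : (-1 : ℝ) < n := by linarith [hx.1, hy.2.1.2]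
    have h4 : (n : ℝ) < 1 := by linarith [hx.2, hy.2.1.1]
    have h3' : -1 < n := by exact_mod_cast h3
    have h4' : n < 1 := by exact_mod_cast h4
    omega
  refine ⟨(G.right ^ (-m)) j, ?_⟩
  rw [hmn, hn, strip_add_int]
  rw [zpow_neg, ← Equiv.Perm.mul_apply, mul_inv_cancel, Equiv.Perm.one_apply, Int.cast_zero,
    add_zero]
  rw [strip_of_mem_tile _ _ y.2, point_coe]

theorem strip_eq_rightMap (a : Ioo (0 : ℝ) 1) (i : I) (d : rightDom a) :
    G.strip i d = G.rightMap a i d := by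
  obtain ⟨⟨x, y⟩, ⟨hx0, hx1⟩, hy⟩ := d
  have ha := a.2
  simp only at hx0 hx1 hy
  have hd : (x, y) ∈ stripDom := mem_stripDom_of_snd hy
  by_cases hx : x ≤ 1
  · rw [G.strip_eq_point i hd (n := 0) (by simp; linarith [ha.1]) (by simpa using hx)]
    simp only [rightMap, hx, if_true]
    rw [G.point_of_mem _ (sub_int_mem_tile (n := 0) hd (by simp; linarith [ha.1])
      (by simpa using hx))]
    simp [hx]
  · rw [G.strip_eq_point i hd (n := 1) (by simp; linarith) (by simp; linarith [ha.2])]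
    simp only [rightMap, hx, if_false]
    rw [G.point_of_mem _ (sub_int_mem_tile (n := 1) hd (by simp; linarith)
      (by simp; linarith [ha.2]))]
    simp [max_eq_left (show 0 ≤ x - 1 by linarith)]

theorem strip_image_rightDom_mem_nhds (a : Ioo (0 : ℝ) 1) (i : I) {d : ℝ × ℝ}
    (hd : d ∈ rightDom a) : G.strip i '' rightDom a ∈ 𝓝 (G.strip i d) := by
  have h : G.strip i '' rightDom a = range (G.rightMap a i) := by
    ext p
    simp [← strip_eq_rightMap]
  rw [h]
  refine (G.rightMap_isOpenEmbedding a i).isOpen_range.mem_nhds ⟨⟨d, hd⟩, ?_⟩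
  rw [← strip_eq_rightMap]

/-- Unique lifting: a continuous family of points that covers a family of points of the open
strip stays in one strip. -/
theorem exists_strip_lift {Y : Type*} [TopologicalSpace Y] [PreconnectedSpace Y] [Nonempty Y]
    {φ : Y → G.Surface} (hφ : Continuous φ) {ψ : Y → ℝ × ℝ} (hψ : Continuous ψ)
    (h01 : ∀ y, (ψ y).2 ∈ Ioo (0 : ℝ) 1) (h : ∀ y, G.toTorus (φ y) = torusMk (ψ y)) :
    ∃ i, ∀ y, φ y = G.strip i (ψ y) := by
  choose k hk using fun y => G.exists_strip_eq (h01 y) (h y)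
  have hloc : IsLocallyConstant k := by
    refine (IsLocallyConstant.iff_eventually_eq k).2 fun y => ?_
    obtain ⟨n, a, ha⟩ : ∃ (n : ℤ) (a : Ioo (0 : ℝ) 1),
        (ψ y).1 - n ∈ Ioo (a : ℝ) (a + 1) := by
      have h1 := Int.le_ceil (ψ y).1
      have h2 := Int.ceil_lt_add_one (ψ y).1
      refine ⟨⌈(ψ y).1⌉ - 1, ⟨((ψ y).1 - (⌈(ψ y).1⌉ - 1)) / 2, ?_, ?_⟩, ?_, ?_⟩ <;>
        push_cast <;> linarith
    have hs : ∀ (i : I) (x : ℝ × ℝ),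
        G.strip i x = G.strip ((G.right ^ n) i) (x.1 - n, x.2) := fun i x => by
      rw [← strip_add_int, sub_add_cancel]
    -- near `ψ y` the strip is a sheet of the chart with inverse `rightMap a`, up to a translation
    have hnhds := G.strip_image_rightDom_mem_nhds a ((G.right ^ n) (k y))
      (d := ((ψ y).1 - n, (ψ y).2)) ⟨ha, h01 y⟩
    rw [← hs, hk] at hnhds
    have hψ' : ∀ᶠ z in 𝓝 y, (ψ z).1 - n ∈ Ioo (a : ℝ) (a + 1) :=
      (by fun_prop : Continuous fun z => (ψ z).1 - n).continuousAt.eventually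
        (isOpen_Ioo.mem_nhds ha)
    filter_upwards [hφ.continuousAt.eventually hnhds, hψ'] with z ⟨d, hd, hdz⟩ hz
    have hd2 : d.2 ∈ Ioo (0 : ℝ) 1 := hd.2
    have h3 : torusMk d = torusMk ((ψ z).1 - n, (ψ z).2) := by
      rw [torusMk_sub_int, ← h, ← hdz, toTorus_strip _ _ (mem_stripDom_of_snd hd2)]
    obtain ⟨m, l, hml⟩ := torusMk_eq_iff.1 h3
    have hd1 := hd.1
    have h01z := h01 z
    have e1 : d.1 = (ψ z).1 - n + m := congrArg Prod.fst hml
    have e2 : d.2 = (ψ z).2 + l := congrArg Prod.snd hml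
    have key : ∀ {u v b : ℝ} {c : ℤ}, u = v + c → u ∈ Ioo b (b + 1) → v ∈ Ioo b (b + 1) →
        c = 0 := by
      rintro u v b c huv ⟨hu0, hu1⟩ ⟨hv0, hv1⟩
      have h3 : (-1 : ℝ) < c := by linarith
      have h4 : (c : ℝ) < 1 := by linarith
      have h3' : -1 < c := by exact_mod_cast h3
      have h4' : c < 1 := by exact_mod_cast h4
      omega
    have hm := key e1 hd1 hz
    have hl := key (b := 0) e2 (by simpa using hd2) (by simpa using h01z)
    rw [hm, hl] at hml
    simp only [Int.cast_zero, add_zero] at hml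
    refine G.strip_index_injective h01z ?_
    rw [hk, ← hdz, hml, ← hs]
  obtain ⟨y0⟩ := ‹Nonempty Y›
  refine ⟨k y0, fun y => ?_⟩
  rw [← hk y, hloc.apply_eq_of_preconnectedSpace y y0]

end Gluing

/-! ### Homeomorphisms between glued surfaces that cover integral linear maps -/

/-- The action of an integral matrix on the torus `ℝ² / ℤ²`. -/
def torusAct (N : Matrix (Fin 2) (Fin 2) ℤ) (z : UnitAddCircle × UnitAddCircle) :
    UnitAddCircle × UnitAddCircle :=
  (N 0 0 • z.1 + N 0 1 • z.2, N 1 0 • z.1 + N 1 1 • z.2)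

/-- The action of a real matrix on `ℝ × ℝ`. -/
def planeAct (P : Matrix (Fin 2) (Fin 2) ℝ) (x : ℝ × ℝ) : ℝ × ℝ :=
  (P 0 0 * x.1 + P 0 1 * x.2, P 1 0 * x.1 + P 1 1 * x.2)

theorem continuous_torusAct (N : Matrix (Fin 2) (Fin 2) ℤ) : Continuous (torusAct N) := by
  unfold torusAct
  fun_prop

theorem torusAct_torusMk (N : Matrix (Fin 2) (Fin 2) ℤ) (x : ℝ × ℝ) :
    torusAct N (torusMk x) = torusMk (planeAct (N.map (fun n : ℤ => (n : ℝ))) x) := by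
  simp [torusAct, torusMk, planeAct, ← zsmul_eq_mul]

theorem torusAct_one (z : UnitAddCircle × UnitAddCircle) : torusAct 1 z = z := by
  simp [torusAct]

theorem torusAct_mul (A B : Matrix (Fin 2) (Fin 2) ℤ) (z : UnitAddCircle × UnitAddCircle) :
    torusAct (A * B) z = torusAct A (torusAct B z) := by
  ext <;> simp only [torusAct, Matrix.mul_apply, Fin.sum_univ_two] <;> module

/-- The matrix of the map `(s, t) ↦ (t, s)`. -/
def glSwap : GL (Fin 2) ℤ := ⟨!![0, 1; 1, 0], !![0, 1; 1, 0], by decide, by decide⟩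

/-- The matrix of the map `(s, t) ↦ (-s, t)`. -/
def glFlip : GL (Fin 2) ℤ := ⟨!![-1, 0; 0, 1], !![-1, 0; 0, 1], by decide, by decide⟩

/-- The matrix of the map `(s, t) ↦ (s + t, t)`. -/
def glShear : GL (Fin 2) ℤ := ⟨!![1, 1; 0, 1], !![1, -1; 0, 1], by decide, by decide⟩

namespace Gluing

variable {I J K : Type}

/-- There is a homeomorphism between the surfaces that covers the automorphism `N` of the torus. In
coordinates it is affine with linear part `N` and an integral translation part. -/
def IntAffine (G : Gluing I) (G' : Gluing J) (N : GL (Fin 2) ℤ) : Prop :=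
  ∃ f : G.Surface ≃ₜ G'.Surface, ∀ p, G'.toTorus (f p) = torusAct N.val (G.toTorus p)

theorem IntAffine.refl (G : Gluing I) : IntAffine G G 1 :=
  ⟨Homeomorph.refl _, fun _ => (torusAct_one _).symm⟩

theorem IntAffine.symm {G : Gluing I} {G' : Gluing J} {N : GL (Fin 2) ℤ}
    (h : IntAffine G G' N) : IntAffine G' G N⁻¹ := by
  obtain ⟨f, hf⟩ := h
  refine ⟨f.symm, fun p => ?_⟩
  have h1 := hf (f.symm p)
  rw [f.apply_symm_apply] at h1
  rw [h1, ← torusAct_mul, ← Units.val_mul, inv_mul_cancel, Units.val_one, torusAct_one]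

theorem IntAffine.trans {G : Gluing I} {G' : Gluing J} {G'' : Gluing K} {N N' : GL (Fin 2) ℤ}
    (h : IntAffine G G' N) (h' : IntAffine G' G'' N') : IntAffine G G'' (N' * N) := by
  obtain ⟨f, hf⟩ := h
  obtain ⟨f', hf'⟩ := h'
  refine ⟨f.trans f', fun p => ?_⟩
  rw [Units.val_mul, torusAct_mul, ← hf, ← hf']
  rfl

theorem intAffine_of_descend {G : Gluing I} {G' : Gluing J} {N : GL (Fin 2) ℤ}
    (f : C(G.Surface, G'.Surface)) (g : C(G'.Surface, G.Surface))
    (hgf : ∀ i x, g (f (G.pt i x)) = G.pt i x) (hfg : ∀ i x, f (g (G'.pt i x)) = G'.pt i x)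
    (hf : ∀ i x, G'.toTorus (f (G.pt i x)) = torusAct N.val (torusMk x.1)) :
    IntAffine G G' N := by
  refine ⟨⟨⟨f, g, fun p => ?_, fun p => ?_⟩, f.continuous, g.continuous⟩, fun p => ?_⟩
  · obtain ⟨i, x, rfl⟩ := G.exists_pt p
    exact hgf i x
  · obtain ⟨i, x, rfl⟩ := G'.exists_pt p
    exact hfg i x
  · obtain ⟨i, x, rfl⟩ := G.exists_pt p
    exact hf i x

variable (G : Gluing I)

theorem continuous_point_comp (i : I) {h : Tile → ℝ × ℝ} (hc : Continuous h)
    (hm : ∀ x, h x ∈ Tile) : Continuous fun x => G.point i (h x) :=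
  (G.continuousOn_point i).comp_continuous hc hm

/-- Renaming of the copies of the rhombus. -/
theorem intAffine_relabel (G' : Gluing J) (σ : I ≃ J)
    (hr : ∀ i, σ (G.right i) = G'.right (σ i)) (hu : ∀ i, σ (G.up i) = G'.up (σ i)) :
    IntAffine G G' 1 := by
  refine intAffine_of_descend
    (G.descend (fun i x => G'.pt (σ i) x) (fun i => G'.continuous_pt _) ?_ ?_)
    (G'.descend (fun j x => G.pt (σ.symm j) x) (fun i => G.continuous_pt _) ?_ ?_) ?_ ?_ ?_
  · intro i t ht
    rw [hr, G'.pt_right _ _ ht]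
  · intro i s hs
    rw [hu, G'.pt_up _ _ hs]
  · intro j t ht
    rw [G.pt_right _ _ ht, ← σ.symm_apply_apply (G.right _), hr, σ.apply_symm_apply]
  · intro j s hs
    rw [G.pt_up _ _ hs, ← σ.symm_apply_apply (G.up _), hu, σ.apply_symm_apply]
  · intro i x
    change G.pt (σ.symm (σ i)) x = _
    rw [σ.symm_apply_apply]
  · intro i x
    change G'.pt (σ (σ.symm i)) x = _
    rw [σ.apply_symm_apply]
  · intro i x
    exact (torusAct_one _).symm

theorem swap_mem_tile {x : ℝ × ℝ} (hx : x ∈ Tile) : (x.2, x.1) ∈ Tile := by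
  obtain ⟨⟨h1, h2⟩, h3⟩ := hx
  exact ⟨⟨h2, h1⟩, fun h => h3 ⟨h.2, h.1⟩⟩

theorem flip_mem_tile {x : ℝ × ℝ} (hx : x ∈ Tile) : (1 - x.1, x.2) ∈ Tile := by
  obtain ⟨⟨⟨h0, h1⟩, h2⟩, h3⟩ := hx
  refine ⟨⟨⟨by simp only; linarith, by simp only; linarith⟩, h2⟩, fun h => h3 ⟨?_, h.2⟩⟩
  rcases h.1 with h | h
  · exact Or.inr (by simp only at h; simp only [mem_singleton_iff]; linarith)
  · exact Or.inl (by simp only [mem_singleton_iff] at h; linarith)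

/-- The map `(s, t) ↦ (t, s)` of each copy exchanges the two permutations. -/
theorem intAffine_swap : IntAffine G ⟨G.up, G.right⟩ glSwap := by
  have key : ∀ (H : Gluing I), ∃ f : C(H.Surface, (⟨H.up, H.right⟩ : Gluing I).Surface),
      ∀ i x, f (H.pt i x) = (⟨H.up, H.right⟩ : Gluing I).point i (x.1.2, x.1.1) := fun H =>
    ⟨H.descend _ (fun i => continuous_point_comp _ i (by fun_prop) fun x => swap_mem_tile x.2)
      (fun i t ht => point_up _ i ht) (fun i s hs => point_right _ i hs), fun _ _ => rfl⟩
  obtain ⟨f, hf⟩ := key G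
  obtain ⟨g, hg⟩ := key ⟨G.up, G.right⟩
  refine intAffine_of_descend f g (fun i x => ?_) (fun i x => ?_) (fun i x => ?_)
  · rw [hf, point_of_mem _ _ (swap_mem_tile x.2), hg]
    exact point_coe _ _ _
  · rw [hg, point_of_mem _ _ (swap_mem_tile x.2)]
    refine (hf _ _).trans (point_coe _ _ _)
  · rw [hf, toTorus_point _ _ (swap_mem_tile x.2)]
    simp [torusAct, glSwap, torusMk]

/-- The map `(s, t) ↦ (1 - s, t)` of each copy inverts the first permutation. -/
theorem intAffine_flip : IntAffine G ⟨G.right⁻¹, G.up⟩ glFlip := by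
  have key : ∀ (H H' : Gluing I), H'.right = H.right⁻¹ → H'.up = H.up →
      ∃ f : C(H.Surface, H'.Surface),
        ∀ i x, f (H.pt i x) = H'.point i (1 - x.1.1, x.1.2) := fun H H' hr hu =>
    ⟨H.descend _ (fun i => continuous_point_comp _ i (by fun_prop) fun x => flip_mem_tile x.2)
      (fun i t ht => by simpa [hr] using (point_right H' (H.right i) ht).symm)
      (fun i s hs => by
        rw [← hu]; exact point_up _ i
          ⟨by simp only; linarith [hs.2], by simp only; linarith [hs.1]⟩),
      fun _ _ => rfl⟩
  obtain ⟨f, hf⟩ := key G ⟨G.right⁻¹, G.up⟩ rfl rfl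
  obtain ⟨g, hg⟩ := key ⟨G.right⁻¹, G.up⟩ G (inv_inv _).symm rfl
  refine intAffine_of_descend f g (fun i x => ?_) (fun i x => ?_) (fun i x => ?_)
  · rw [hf, point_of_mem _ _ (flip_mem_tile x.2), hg]
    simpa using point_coe _ _ _
  · rw [hg, point_of_mem _ _ (flip_mem_tile x.2), hf]
    simpa using point_coe _ _ _
  · rw [hf, toTorus_point _ _ (flip_mem_tile x.2)]
    simp [torusAct, glFlip, torusMk]

theorem shear_mem_stripDom {x : ℝ × ℝ} (hx : x ∈ stripDom) (c : ℤ) :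
    (x.1 + c * x.2, x.2) ∈ stripDom := by
  refine ⟨hx.1, fun h => ?_⟩
  obtain ⟨m, n, hmn⟩ := torusMk_eq_zero_iff.1 h
  rw [Prod.mk.injEq] at hmn
  refine hx.2 (torusMk_eq_zero_iff.2 ⟨m - c * n, n, Prod.ext ?_ hmn.2⟩)
  push_cast
  rw [← hmn.1, ← hmn.2]
  ring

/-- The shear `(s, t) ↦ (s + t, t)` of each horizontal strip fixes its lower edge and translates
its upper edge by one copy of the rhombus. -/
theorem intAffine_shear : IntAffine G ⟨G.right, G.up * G.right⁻¹⟩ glShear := by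
  have key : ∀ (H H' : Gluing I) (c : ℤ), H'.right = H.right →
      H'.up * H.right ^ c = H.up →
      ∃ f : C(H.Surface, H'.Surface), ∀ i, ∀ x ∈ stripDom,
        f (H.strip i x) = H'.strip i (x.1 + c * x.2, x.2) := by
    intro H H' c hr hu
    refine ⟨H.descend (fun i x => H'.strip i (x.1.1 + c * x.1.2, x.1.2))
      (fun i => (H'.continuousOn_strip i).comp_continuous (by fun_prop)
        fun x => shear_mem_stripDom (tile_subset_stripDom x.2) c)
      (fun i t ht => ?_) (fun i s hs => ?_), fun i x hx => ?_⟩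
    · have := H'.strip_add_int i (c * t) t 1
      rw [hr] at this
      simpa [add_comm] using this
    · have h1 := H'.strip_add_int i s 1 c
      have hs1 : (s, (1 : ℝ)) ∈ Tile := tile_of_snd hs zero_le_one le_rfl
      have hs0 : (s, (0 : ℝ)) ∈ Tile := tile_of_snd hs le_rfl zero_le_one
      simp only [mul_one, mul_zero, add_zero]
      rw [h1, strip_of_mem_tile _ _ hs1, strip_of_mem_tile _ _ hs0, point_up _ _ hs, hr, ← hu]
      rfl
    · rw [strip, point_of_mem _ _ (fract_mem_tile hx)]
      change H'.strip _ (Int.fract x.1 + c * x.2, x.2) = _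
      rw [← hr, ← strip_add_int]
      congr 2
      rw [add_right_comm, Int.fract_add_floor]
  obtain ⟨f, hf⟩ := key G ⟨G.right, G.up * G.right⁻¹⟩ 1 rfl (by simp)
  obtain ⟨g, hg⟩ := key ⟨G.right, G.up * G.right⁻¹⟩ G (-1) rfl (by simp)
  have hpt : ∀ (H : Gluing I) i (x : Tile), H.pt i x = H.strip i x := fun H i x => by
    rw [strip_of_mem_tile _ _ x.2, point_coe]
  refine intAffine_of_descend f g (fun i x => ?_) (fun i x => ?_) (fun i x => ?_) <;>
    have hx := tile_subset_stripDom x.2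
  · rw [hpt, hf _ _ hx, hg _ _ (shear_mem_stripDom hx 1)]
    simp
  · rw [hpt, hg _ _ hx, hf _ _ (shear_mem_stripDom hx (-1))]
    simp
  · rw [hpt, hf _ _ hx, toTorus_strip _ _ (shear_mem_stripDom hx 1)]
    simp [torusAct, glShear, torusMk]

end Gluing

/-! ### Affine automorphisms are the lifts of integral linear maps -/

/-- Two lifts of the same map to the torus differ by a constant, locally. -/
theorem eventually_sub_eq_of_torusMk_eq {X : Type*} [TopologicalSpace X] {α β : X → ℝ × ℝ} {x : X}
    (hα : ContinuousAt α x) (hβ : ContinuousAt β x)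
    (h : ∀ᶠ y in 𝓝 x, torusMk (α y) = torusMk (β y)) :
    ∀ᶠ y in 𝓝 x, α y - β y = α x - β x := by
  have hZ : ∀ y, torusMk (α y) = torusMk (β y) → ∃ m n : ℤ, α y - β y = ((m : ℝ), (n : ℝ)) := by
    intro y hy
    obtain ⟨m, n, hmn⟩ := torusMk_eq_iff.1 hy
    exact ⟨m, n, by rw [hmn]; ext <;> simp⟩
  obtain ⟨m, n, hmn⟩ := hZ x h.self_of_nhds
  have h1 : ∀ᶠ y in 𝓝 x, α y - β y ∈ Metric.ball (α x - β x) 1 :=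
    (hα.sub hβ).eventually (Metric.ball_mem_nhds _ one_pos)
  filter_upwards [h, h1] with y hy hb
  obtain ⟨k, l, hkl⟩ := hZ y hy
  rw [hmn, hkl, Metric.mem_ball, Prod.dist_eq, max_lt_iff, Real.dist_eq, Real.dist_eq] at hb
  simp only at hb
  rw [hmn, hkl]
  have e1 : |k - m| < 1 := by exact_mod_cast hb.1
  have e2 : |l - n| < 1 := by exact_mod_cast hb.2
  rw [Int.abs_lt_one_iff] at e1 e2
  rw [sub_eq_zero.1 e1, sub_eq_zero.1 e2]

theorem rhombusPoint_add (x y : ℝ × ℝ) :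
    rhombusPoint (x + y) = rhombusPoint x + rhombusPoint y := by
  simp only [rhombusPoint, Homeomorph.homeomorph_mk_coe, Equiv.coe_fn_mk, Prod.fst_add,
    Prod.snd_add]
  module

theorem rhombusPoint_symm_add (x y : Plane) :
    rhombusPoint.symm (x + y) = rhombusPoint.symm x + rhombusPoint.symm y := by
  rw [Homeomorph.symm_apply_eq, rhombusPoint_add]
  simp

theorem rhombusPoint_eq (x : ℝ × ℝ) : rhombusPoint x = -(basisMatrix.val.mulVec ![x.1, x.2]) := by
  ext i
  fin_cases i <;>
    simp [rhombusPoint, basisMatrix, Matrix.GeneralLinearGroup.mkOfDetNeZero] <;> ring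

/-- The matrix of a linear map of the plane in the basis `{v₁, v₂}`. -/
noncomputable def toBasis (M : GL (Fin 2) ℝ) : GL (Fin 2) ℝ := basisMatrix⁻¹ * M * basisMatrix

theorem mulVec_rhombusPoint (M : GL (Fin 2) ℝ) (x : ℝ × ℝ) :
    M.val.mulVec (rhombusPoint x) = rhombusPoint (planeAct (toBasis M).val x) := by
  have h1 : M.val * basisMatrix.val = basisMatrix.val * (toBasis M).val := by
    rw [← Units.val_mul, ← Units.val_mul, toBasis]
    congr 1
    group
  have h2 : ![(planeAct (toBasis M).val x).1, (planeAct (toBasis M).val x).2] =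
      (toBasis M).val.mulVec ![x.1, x.2] := by
    ext i
    fin_cases i <;> simp [planeAct, Matrix.mulVec, dotProduct, Fin.sum_univ_two]
  rw [rhombusPoint_eq, rhombusPoint_eq, h2, Matrix.mulVec_neg, Matrix.mulVec_mulVec, h1,
    Matrix.mulVec_mulVec]

theorem toBasis_inBasis (N : GL (Fin 2) ℤ) :
    toBasis (inBasis N) = Matrix.GeneralLinearGroup.map (Int.castRingHom ℝ) N := by
  rw [toBasis, inBasis]
  group

theorem inBasis_eq_iff {N : GL (Fin 2) ℤ} {M : GL (Fin 2) ℝ} :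
    inBasis N = M ↔ N.val.map (fun n : ℤ => (n : ℝ)) = (toBasis M).val := by
  constructor
  · rintro rfl
    rw [toBasis_inBasis]
    rfl
  · intro h
    have h' : Matrix.GeneralLinearGroup.map (Int.castRingHom ℝ) N = toBasis M := Units.ext h
    rw [inBasis, h', toBasis]
    group

theorem continuous_planeAct (P : Matrix (Fin 2) (Fin 2) ℝ) : Continuous (planeAct P) := by
  unfold planeAct
  fun_prop

theorem planeAct_add (P : Matrix (Fin 2) (Fin 2) ℝ) (x y : ℝ × ℝ) :
    planeAct P (x + y) = planeAct P x + planeAct P y := by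
  ext <;> simp [planeAct] <;> ring

/-- The open strip `0 < t < 1`. -/
def openStrip : Set (ℝ × ℝ) := univ ×ˢ Ioo 0 1

theorem isOpen_openStrip : IsOpen openStrip := isOpen_univ.prod isOpen_Ioo

theorem convex_openStrip : Convex ℝ openStrip := convex_univ.prod (convex_Ioo 0 1)

theorem closure_openStrip : closure openStrip = univ ×ˢ Icc 0 1 := by
  rw [openStrip, closure_prod_eq, closure_univ, closure_Ioo zero_ne_one]

theorem openStrip_subset_stripDom : openStrip ⊆ Gluing.stripDom :=
  fun _ hx => Gluing.mem_stripDom_of_snd hx.2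

namespace Gluing

variable {I : Type} (G : Gluing I)

/-- In charts, `f` and `N` differ by integral vectors, which are locally constant. -/
theorem isAffineAut_of_covers {f : G.Surface ≃ₜ G.Surface} {N : GL (Fin 2) ℤ}
    (hf : ∀ p, G.toTorus (f p) = torusAct N.val (G.toTorus p)) : IsAffineAut f (inBasis N) := by
  intro e he e' he' p hp hp'
  have hP := inBasis_eq_iff.1 (rfl : inBasis N = inBasis N)
  have h1 : ∀ᶠ q in 𝓝 p, q ∈ e.source := e.open_source.mem_nhds hp
  have hfc : ContinuousAt f p := f.continuous.continuousAt
  have h2 : ∀ᶠ q in 𝓝 p, f q ∈ e'.source := hfc.eventually (e'.open_source.mem_nhds hp')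
  have hα : ContinuousAt (fun q => rhombusPoint.symm (e' (f q))) p :=
    rhombusPoint.symm.continuous.continuousAt.comp
      ((e'.continuousAt hp').comp (f := f) hfc)
  have hβ : ContinuousAt
      (fun q => planeAct (toBasis (inBasis N)).val (rhombusPoint.symm (e q))) p :=
    ((continuous_planeAct _).comp rhombusPoint.symm.continuous).continuousAt.comp
      (e.continuousAt hp)
  have h3 := eventually_sub_eq_of_torusMk_eq hα hβ (by
    filter_upwards [h1, h2] with q hq hq'
    rw [← hP, ← torusAct_torusMk]
    refine (G.toTorus_chart he' hq').symm.trans ((hf q).trans ?_)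
    rw [G.toTorus_chart he hq]
    rfl)
  refine ⟨rhombusPoint (rhombusPoint.symm (e' (f p)) -
    planeAct (toBasis (inBasis N)).val (rhombusPoint.symm (e p))), ?_⟩
  filter_upwards [h3] with q hq
  rw [← hq, ← rhombusPoint.apply_symm_apply (e q), mulVec_rhombusPoint, ← rhombusPoint_add,
    rhombusPoint.symm_apply_apply, add_sub_cancel, rhombusPoint.apply_symm_apply]

/-- An affine automorphism is affine on each strip. -/
theorem exists_toTorus_strip_eq {f : G.Surface ≃ₜ G.Surface} {M : GL (Fin 2) ℝ}
    (hf : IsAffineAut f M) (i : I) : ∃ b, ∀ x ∈ openStrip,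
      G.toTorus (f (G.strip i x)) = torusMk (planeAct (toBasis M).val x + b) := by
  set P := (toBasis M).val
  have hloc : IsLocallyConstant fun x : openStrip =>
      G.toTorus (f (G.strip i x)) - torusMk (planeAct P x) := by
    refine (IsLocallyConstant.iff_eventually_eq _).2 fun x => ?_
    have hcont : ContinuousAt (fun y : openStrip => G.strip i y) x :=
      ((G.continuousOn_strip i).comp_continuous continuous_subtype_val
        fun y => openStrip_subset_stripDom y.2).continuousAt
    obtain ⟨e, he, hp⟩ := G.exists_chart (G.strip i x)
    obtain ⟨e', he', hp'⟩ := G.exists_chart (f (G.strip i x))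
    obtain ⟨c, hc⟩ := hf e he e' he' _ hp hp'
    have h1 : ∀ᶠ y : openStrip in 𝓝 x, G.strip i y ∈ e.source :=
      hcont.eventually (e.open_source.mem_nhds hp)
    have h2 : ∀ᶠ y : openStrip in 𝓝 x, f (G.strip i y) ∈ e'.source :=
      (f.continuous.continuousAt.comp (f := fun y : openStrip => G.strip i y) hcont).eventually
        (e'.open_source.mem_nhds hp')
    have hα : ContinuousAt (fun y : openStrip => rhombusPoint.symm (e (G.strip i y))) x :=
      rhombusPoint.symm.continuous.continuousAt.comp
        ((e.continuousAt hp).comp (f := fun y : openStrip => G.strip i y) hcont)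
    have h3 := eventually_sub_eq_of_torusMk_eq hα continuous_subtype_val.continuousAt (by
      filter_upwards [h1] with y hy
      exact (G.toTorus_chart he hy).symm.trans
        (G.toTorus_strip i (openStrip_subset_stripDom y.2)))
    have h4 : ∀ᶠ y : openStrip in 𝓝 x, G.toTorus (f (G.strip i y)) - torusMk (planeAct P y) =
        torusMk (planeAct P (rhombusPoint.symm (e (G.strip i x)) - x) + rhombusPoint.symm c) := by
      filter_upwards [h1, h2, h3, hcont.eventually hc] with y hy hy' hy3 hyc
      have h5 : G.toTorus (f (G.strip i y)) =
        torusMk (rhombusPoint.symm (e' (f (G.strip i y)))) := G.toTorus_chart he' hy'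
      rw [h5, hyc, ← rhombusPoint.apply_symm_apply (e (G.strip i y)), mulVec_rhombusPoint,
        rhombusPoint_symm_add, rhombusPoint.symm_apply_apply, sub_eq_iff_eq_add, ← torusMk_add,
        ← hy3, add_right_comm, ← planeAct_add, sub_add_cancel]
    filter_upwards [h4] with y hy
    rw [hy, h4.self_of_nhds]
  have : PreconnectedSpace openStrip :=
    Subtype.preconnectedSpace convex_openStrip.isPreconnected
  have hx0 : ((0, 1 / 2) : ℝ × ℝ) ∈ openStrip := ⟨trivial, by norm_num, by norm_num⟩
  obtain ⟨b, hb⟩ := torusMk_surjective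
    (G.toTorus (f (G.strip i (0, 1 / 2))) - torusMk (planeAct P (0, 1 / 2)))
  refine ⟨b, fun x hx => ?_⟩
  have := hloc.apply_eq_of_preconnectedSpace ⟨x, hx⟩ ⟨_, hx0⟩
  simp only at this
  rw [← hb] at this
  rw [torusMk_add, ← this, add_sub_cancel]

theorem exists_tendsto_of_snd {D : Set (ℝ × ℝ)} (hD : Convex ℝ D) {c : ℝ × ℝ} (hc : c ∈ closure D)
    {φ : ℝ × ℝ → G.Surface} (hφ : ContinuousOn φ D) {P : Matrix (Fin 2) (Fin 2) ℝ} {b : ℝ × ℝ}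
    (h : ∀ x ∈ D, G.toTorus (φ x) = torusMk (planeAct P x + b))
    (hne : ∀ n : ℤ, (planeAct P c + b).2 ≠ n) : ∃ q, Filter.Tendsto φ (𝓝[D] c) (𝓝 q) := by
  set n := ⌊(planeAct P c + b).2⌋ with hn
  set ψ : ℝ × ℝ → ℝ × ℝ := fun x => planeAct P x + b - (0, (n : ℝ)) with hψ
  have hψc : Continuous ψ := by
    have := continuous_planeAct P
    fun_prop
  have hc01 : (ψ c).2 ∈ Ioo (0 : ℝ) 1 := by
    have h1 := Int.floor_le (planeAct P c + b).2
    have h2 := Int.lt_floor_add_one (planeAct P c + b).2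
    rw [← hn] at h1 h2
    have h3 := lt_of_le_of_ne h1 (hne n).symm
    simp only [hψ, Prod.snd_sub]
    constructor <;> linarith
  set D' : Set (ℝ × ℝ) := D ∩ {x | (ψ x).2 ∈ Ioo (0 : ℝ) 1} with hD'
  have hev : ∀ᶠ x in 𝓝 c, (ψ x).2 ∈ Ioo (0 : ℝ) 1 :=
    (continuous_snd.comp hψc).continuousAt.eventually (isOpen_Ioo.mem_nhds hc01)
  have hconv : Convex ℝ D' := by
    refine hD.inter fun x hx y hy u v hu hv huv => ?_
    have := convex_Ioo (0 : ℝ) 1 hx hy hu hv huv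
    have e : (ψ (u • x + v • y)).2 = u • (ψ x).2 + v • (ψ y).2 := by
      simp only [hψ, planeAct, Prod.snd_sub, Prod.snd_add, Prod.fst_add, Prod.smul_fst,
        Prod.smul_snd, smul_eq_mul]
      linear_combination (n - b.2) * huv
    rw [mem_ofPred_eq, e]
    exact this
  have hnb : (𝓝[D] c).NeBot := mem_closure_iff_nhdsWithin_neBot.1 hc
  have hmem : ∀ᶠ x in 𝓝[D] c, x ∈ D' :=
    Filter.inter_mem self_mem_nhdsWithin (hev.filter_mono nhdsWithin_le_nhds)
  have : PreconnectedSpace D' := Subtype.preconnectedSpace hconv.isPreconnected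
  have : Nonempty D' := hmem.exists.elim fun x hx => ⟨⟨x, hx⟩⟩
  obtain ⟨j, hj⟩ := G.exists_strip_lift (Y := D') (φ := fun x => φ x) (ψ := fun x => ψ x)
    ((hφ.mono inter_subset_left).comp_continuous continuous_subtype_val fun x => x.2)
    (hψc.comp continuous_subtype_val) (fun x => x.2.2) (fun x => by
      rw [h x x.2.1]
      exact torusMk_eq_iff.2 ⟨0, n, by ext <;> simp [hψ]⟩)
  refine ⟨G.strip j (ψ c), ?_⟩
  have hcs : ψ c ∈ openStrip := ⟨trivial, hc01⟩
  have ht : Filter.Tendsto (fun x => G.strip j (ψ x)) (𝓝[D] c) (𝓝 (G.strip j (ψ c))) :=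
    (((G.continuousOn_strip j).mono openStrip_subset_stripDom).continuousAt
      (isOpen_openStrip.mem_nhds hcs)).tendsto.comp
      (hψc.continuousAt.tendsto.mono_left nhdsWithin_le_nhds)
  refine ht.congr' ?_
  filter_upwards [hmem] with x hx
  exact (hj ⟨x, hx⟩).symm

/-- A family of points over an affine image of a convex set has a limit at `c`, unless the affine
map carries `c` to a lattice point. -/
theorem exists_tendsto {D : Set (ℝ × ℝ)} (hD : Convex ℝ D) {c : ℝ × ℝ} (hc : c ∈ closure D)
    {φ : ℝ × ℝ → G.Surface} (hφ : ContinuousOn φ D) {P : Matrix (Fin 2) (Fin 2) ℝ} {b : ℝ × ℝ}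
    (h : ∀ x ∈ D, G.toTorus (φ x) = torusMk (planeAct P x + b))
    (hne : torusMk (planeAct P c + b) ≠ 0) : ∃ q, Filter.Tendsto φ (𝓝[D] c) (𝓝 q) := by
  by_cases hs : ∀ n : ℤ, (planeAct P c + b).2 ≠ n
  · exact G.exists_tendsto_of_snd hD hc hφ h hs
  push Not at hs
  obtain ⟨n, hn⟩ := hs
  -- the second coordinate is an integer and the first is not: exchange the coordinates
  obtain ⟨f, hf⟩ := G.intAffine_swap
  have hswap : ∀ x, planeAct !![P 1 0, P 1 1; P 0 0, P 0 1] x + (b.2, b.1) =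
      ((planeAct P x + b).2, (planeAct P x + b).1) := fun x => by
    ext <;> simp [planeAct]
  obtain ⟨q, hq⟩ := exists_tendsto_of_snd _ hD hc (φ := fun x => f (φ x))
    (f.continuous.comp_continuousOn hφ) (P := !![P 1 0, P 1 1; P 0 0, P 0 1]) (b := (b.2, b.1))
    (fun x hx => by rw [hf, h x hx, hswap]; simp [torusAct, glSwap, torusMk])
    (fun m hm => by
      rw [hswap] at hm
      exact hne (torusMk_eq_zero_iff.2 ⟨m, n, Prod.ext hm hn⟩))
  refine ⟨f.symm q, ?_⟩
  simpa [Function.comp_def] using (f.symm.continuous.tendsto q).comp hq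

/-- An affine automorphism carries vertices to vertices: if the image of a vertex `c` under the
affine extension were not a lattice point, the inverse automorphism would carry the limit there to
a limit at `c`. -/
theorem torusMk_eq_zero_of_vertex {f : G.Surface ≃ₜ G.Surface} {P : Matrix (Fin 2) (Fin 2) ℝ}
    {i : I} {b : ℝ × ℝ}
    (h : ∀ x ∈ openStrip, G.toTorus (f (G.strip i x)) = torusMk (planeAct P x + b))
    {c : ℝ × ℝ} (hc : c ∈ closure openStrip) (hc0 : torusMk c = 0) :
    torusMk (planeAct P c + b) = 0 := by
  by_contra hne
  have hs := (G.continuousOn_strip i).mono openStrip_subset_stripDom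
  obtain ⟨q, hq⟩ := G.exists_tendsto convex_openStrip hc (f.continuous.comp_continuousOn hs) h hne
  have hnb : (𝓝[openStrip] c).NeBot := mem_closure_iff_nhdsWithin_neBot.1 hc
  have h1 : Filter.Tendsto (fun x => G.toTorus (G.strip i x)) (𝓝[openStrip] c)
      (𝓝 (G.toTorus (f.symm q))) := by
    simpa [Function.comp_def] using
      ((G.continuous_toTorus.comp f.symm.continuous).tendsto q).comp hq
  have h2 : Filter.Tendsto (fun x => G.toTorus (G.strip i x)) (𝓝[openStrip] c)
      (𝓝 (torusMk c)) := by
    refine (continuous_torusMk.continuousAt.tendsto.mono_left nhdsWithin_le_nhds).congr' ?_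
    filter_upwards [self_mem_nhdsWithin] with x hx
    exact (G.toTorus_strip i (openStrip_subset_stripDom hx)).symm
  have := tendsto_nhds_unique h1 h2
  rw [hc0] at this
  exact G.toTorus_ne_zero _ this

/-- On open strips `f` covers an integral matrix since vertices go to vertices; elsewhere it does so
by continuity. -/
theorem exists_covers_of_isAffineAut [Nonempty I] {f : G.Surface ≃ₜ G.Surface} {M : GL (Fin 2) ℝ}
    (hf : IsAffineAut f M) : ∃ N : Matrix (Fin 2) (Fin 2) ℤ,
      N.map (fun n : ℤ => (n : ℝ)) = (toBasis M).val ∧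
      ∀ p, G.toTorus (f p) = torusAct N (G.toTorus p) := by
  set P := (toBasis M).val
  choose b hb using G.exists_toTorus_strip_eq hf
  have hv : ∀ (i : I) (k l : ℤ), (l : ℝ) ∈ Icc (0 : ℝ) 1 →
      torusMk (planeAct P ((k : ℝ), (l : ℝ)) + b i) = 0 := fun i k l hl =>
    G.torusMk_eq_zero_of_vertex (hb i) (by rw [closure_openStrip]; exact ⟨trivial, hl⟩)
      (torusMk_eq_zero_iff.2 ⟨k, l, rfl⟩)
  have hb0 : ∀ i, torusMk (b i) = 0 := fun i => by
    simpa [planeAct, torusMk_add, torusMk] using hv i 0 0 (by simp)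
  have hP : ∀ k l : ℤ, (l : ℝ) ∈ Icc (0 : ℝ) 1 →
      torusMk (planeAct P ((k : ℝ), (l : ℝ))) = 0 := fun k l hl => by
    obtain ⟨i⟩ := ‹Nonempty I›
    have := hv i k l hl
    rwa [torusMk_add, hb0, add_zero] at this
  obtain ⟨n00, n10, h0⟩ := torusMk_eq_zero_iff.1 (hP 1 0 (by simp))
  obtain ⟨n01, n11, h1⟩ := torusMk_eq_zero_iff.1 (hP 0 1 (by simp))
  simp only [planeAct, Int.cast_one, Int.cast_zero, mul_one, mul_zero, add_zero, zero_add,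
    Prod.mk.injEq] at h0 h1
  have hN : (!![n00, n01; n10, n11] : Matrix (Fin 2) (Fin 2) ℤ).map (fun n : ℤ => (n : ℝ)) = P := by
    ext i j
    fin_cases i <;> fin_cases j <;> simp [h0, h1]
  refine ⟨_, hN, fun p => ?_⟩
  have hE : ∀ i, EqOn (fun x => G.toTorus (f (G.strip i x)))
      (fun x => torusAct !![n00, n01; n10, n11] (G.toTorus (G.strip i x))) stripDom := by
    intro i
    have hs := G.continuousOn_strip i
    refine EqOn.of_subset_closure (s := openStrip) (fun x hx => ?_)
      ((G.continuous_toTorus.comp f.continuous).comp_continuousOn hs)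
      (((continuous_torusAct _).comp G.continuous_toTorus).comp_continuousOn hs)
      openStrip_subset_stripDom (fun x hx => ?_)
    · rw [hb i x hx, G.toTorus_strip i (openStrip_subset_stripDom hx), torusAct_torusMk, hN,
        torusMk_add, hb0, add_zero]
    · rw [closure_openStrip]
      exact ⟨trivial, hx.1⟩
  obtain ⟨i, x, rfl⟩ := G.exists_pt p
  have := hE i (tile_subset_stripDom x.2)
  simp only at this
  rwa [strip_of_mem_tile _ _ x.2, point_coe] at this

/-- The Veech group of a glued surface consists of the integral matrices whose action on the torus
lifts to the surface. -/
theorem veechGroup_eq [Nonempty I] :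
    (veechGroup G.Surface : Set (GL (Fin 2) ℝ)) = inBasis '' {N | IntAffine G G N} := by
  ext M
  constructor
  · intro hM
    obtain ⟨f, hf⟩ := hM
    obtain ⟨f', hf'⟩ : M⁻¹ ∈ veechGroup G.Surface := inv_mem ⟨f, hf⟩
    obtain ⟨N, hN, hNf⟩ := G.exists_covers_of_isAffineAut hf
    obtain ⟨N', hN', -⟩ := G.exists_covers_of_isAffineAut hf'
    have hinj : Function.Injective
        fun A : Matrix (Fin 2) (Fin 2) ℤ => A.map (fun n : ℤ => (n : ℝ)) :=
      Matrix.map_injective Int.cast_injective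
    have hmul : ∀ A B : Matrix (Fin 2) (Fin 2) ℤ, (A * B).map (fun n : ℤ => (n : ℝ)) =
        A.map (fun n : ℤ => (n : ℝ)) * B.map (fun n : ℤ => (n : ℝ)) := fun A B =>
      Matrix.map_mul (f := Int.castRingHom ℝ)
    have hone : (1 : Matrix (Fin 2) (Fin 2) ℤ).map (fun n : ℤ => (n : ℝ)) = 1 :=
      Matrix.map_one _ Int.cast_zero Int.cast_one
    have h1 : N * N' = 1 := hinj <| by
      simp only
      rw [hmul, hN, hN', hone, ← Units.val_mul, ← Units.val_one]
      congr 1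
      simp only [toBasis]
      group
    have h2 : N' * N = 1 := hinj <| by
      simp only
      rw [hmul, hN, hN', hone, ← Units.val_mul, ← Units.val_one]
      congr 1
      simp only [toBasis]
      group
    exact ⟨⟨N, N', h1, h2⟩, ⟨f, hNf⟩, inBasis_eq_iff.2 hN⟩
  · rintro ⟨N, ⟨f, hf⟩, rfl⟩
    exact ⟨f, G.isAffineAut_of_covers hf⟩

end Gluing

/-! ### Closed lines -/

namespace Gluing

variable {I J : Type} (G : Gluing I)

/-- There is a line with velocity `w` in the surface that closes up after time `k`. -/
def HasClosedLine (k : ℕ) (w : Fin 2 → ℤ) : Prop :=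
  ∃ (x : ℝ × ℝ) (γ : ℝ → G.Surface), Continuous γ ∧
    (∀ τ : ℝ, G.toTorus (γ τ) = torusMk (x.1 + τ * w 0, x.2 + τ * w 1)) ∧ γ k = γ 0

variable {G} in
theorem HasClosedLine.map {G' : Gluing J} {k : ℕ} {w : Fin 2 → ℤ} {N : GL (Fin 2) ℤ}
    (h : G.HasClosedLine k w) (hN : IntAffine G G' N) :
    G'.HasClosedLine k (N.val.mulVec w) := by
  obtain ⟨x, γ, hγ, hx, hk⟩ := h
  obtain ⟨f, hf⟩ := hN
  refine ⟨planeAct (N.val.map (fun n : ℤ => (n : ℝ))) x, fun τ => f (γ τ),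
    f.continuous.comp hγ, fun τ => ?_, congrArg f hk⟩
  rw [hf, hx, torusAct_torusMk]
  congr 1
  ext <;> simp [planeAct, Matrix.mulVec, dotProduct, Fin.sum_univ_two] <;> ring

theorem hasClosedLine_horizontal_iff (k : ℕ) :
    G.HasClosedLine k ![1, 0] ↔ ∃ i, (G.right ^ k) i = i := by
  constructor
  · rintro ⟨x, γ, hγ, hx, hk⟩
    simp only [Matrix.cons_val_zero, Matrix.cons_val_one, Int.cast_one, mul_one, Int.cast_zero,
      mul_zero, add_zero] at hx
    have h01 : x.2 - ⌊x.2⌋ ∈ Ioo (0 : ℝ) 1 := by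
      refine ⟨sub_pos.2 (lt_of_le_of_ne (Int.floor_le _) fun h => ?_),
        by linarith [Int.lt_floor_add_one x.2]⟩
      -- a line at integral height runs into a lattice point
      refine G.toTorus_ne_zero (γ (-x.1)) ?_
      rw [hx]
      exact torusMk_eq_zero_iff.2 ⟨0, ⌊x.2⌋, by rw [h]; simp⟩
    obtain ⟨i, hi⟩ := G.exists_strip_lift hγ (ψ := fun τ => (x.1 + τ, x.2 - ⌊x.2⌋))
      (by fun_prop) (fun _ => h01) (fun τ => by
        rw [hx]
        exact torusMk_eq_iff.2 ⟨0, ⌊x.2⌋, by simp⟩)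
    refine ⟨i, G.strip_index_injective (x := (x.1, x.2 - ⌊x.2⌋)) h01 ?_⟩
    rw [hi, hi, ← Int.cast_natCast, strip_add_int, add_zero, zpow_natCast] at hk
    exact hk
  · rintro ⟨i, hi⟩
    have hd : ∀ τ : ℝ, (τ, (1 / 2 : ℝ)) ∈ stripDom := fun τ =>
      mem_stripDom_of_snd ⟨by norm_num, by norm_num⟩
    refine ⟨(0, 1 / 2), fun τ => G.strip i (τ, 1 / 2),
      (G.continuousOn_strip i).comp_continuous (by fun_prop) hd, fun τ => ?_, ?_⟩
    · simpa using G.toTorus_strip i (hd τ)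
    · have := G.strip_add_int i 0 (1 / 2) k
      rw [zpow_natCast, hi] at this
      simpa using this

/-- A shear makes the diagonals horizontal. -/
theorem hasClosedLine_diagonal_iff (k : ℕ) :
    G.HasClosedLine k ![1, 1] ↔ ∃ i, ((G.up * G.right) ^ k) i = i := by
  have h1 : IntAffine G ⟨G.right, G.up * G.right⟩ glShear⁻¹ := by
    have := (intAffine_shear ⟨G.right, G.up * G.right⟩).symm
    rwa [mul_inv_cancel_right] at this
  have h2 := h1.trans (intAffine_swap _)
  rw [← hasClosedLine_horizontal_iff (⟨G.up * G.right, G.right⟩ : Gluing I)]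
  constructor
  · intro h
    exact h.map h2
  · intro h
    exact h.map h2.symm

/-! ### The symmetries of a gluing -/

/-- The subgroup of the integral matrices that lift to the surface. -/
def lifts : Subgroup (GL (Fin 2) ℤ) where
  carrier := {N | IntAffine G G N}
  one_mem' := IntAffine.refl G
  mul_mem' h h' := h'.trans h
  inv_mem' h := h.symm

end Gluing

/-- The parabolic matrix that fixes `(1, 1)`. -/
def glDiag : GL (Fin 2) ℤ := ⟨!![2, -1; 1, 0], !![0, 1; -1, 2], by decide, by decide⟩

namespace Gluing

variable {I : Type} (G : Gluing I)

theorem glShear_pow_mem_lifts (h : G.right ^ 3 = 1) : glShear ^ 3 ∈ G.lifts := by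
  have h3 := ((G.intAffine_shear).trans (intAffine_shear _)).trans (intAffine_shear _)
  have e : G.up * G.right⁻¹ * G.right⁻¹ * G.right⁻¹ = G.up := by
    rw [mul_assoc, mul_assoc, ← pow_three, inv_pow, h, inv_one, mul_one]
  rw [e] at h3
  rwa [pow_three]

theorem glSwap_mem_lifts (σ : I ≃ I) (h : ∀ i, σ (G.up i) = G.right (σ i))
    (h' : ∀ i, σ (G.right i) = G.up (σ i)) : glSwap ∈ G.lifts := by
  have := (G.intAffine_swap).trans (intAffine_relabel _ G σ h h')
  rwa [one_mul] at this

theorem neg_one_mem_lifts (σ : I ≃ I) (h : ∀ i, σ (G.right⁻¹ i) = G.right (σ i))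
    (h' : ∀ i, σ (G.up⁻¹ i) = G.up (σ i)) : -1 ∈ G.lifts := by
  have := ((((G.intAffine_flip).trans (intAffine_swap _)).trans (intAffine_flip _)).trans
    (intAffine_swap _)).trans (intAffine_relabel _ G σ h h')
  have e : 1 * (glSwap * (glFlip * (glSwap * glFlip))) = -1 := Units.ext (by decide)
  rwa [e] at this

/-- `glDiag` is the quarter turn followed by two shears, which change `(right, up)` first to
`(up⁻¹, right)` and then to `(up⁻¹, right * up * up)`. -/
theorem glDiag_mem_lifts (σ : I ≃ I) (h : ∀ i, σ (G.up⁻¹ i) = G.right (σ i))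
    (h' : ∀ i, σ (G.right (G.up (G.up i))) = G.up (σ i)) : glDiag ∈ G.lifts := by
  have := ((((G.intAffine_swap).trans (intAffine_flip _)).trans (intAffine_shear _)).trans
    (intAffine_shear _)).trans (intAffine_relabel _ G σ h (fun i => by simpa using h' i))
  have e : 1 * (glShear * (glShear * (glFlip * glSwap))) = glDiag := Units.ext (by decide)
  rwa [e] at this

end Gluing

/-! ### The symmetries of the lattice -/

/-- A linear automorphism of the plane that permutes the vectors `vᵢ` acts on `2Λ`. -/
theorem exists_addEquiv_twoLambda (L : Plane ≃ₗ[ℝ] Plane) (π : Equiv.Perm (Fin 3))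
    (h : ∀ i, L (eisVec i) = eisVec (π i)) :
    ∃ A : twoLambda ≃+ twoLambda, ∀ i, A (twoVec i) = twoVec (π i) := by
  have hmap : twoLambda.map (L.toAddEquiv : Plane →+ Plane) = twoLambda := by
    rw [twoLambda, AddMonoidHom.map_closure, ← range_comp]
    congr 1
    rw [← π.surjective.range_comp fun i => (2 : ℝ) • eisVec i]
    congr 1
    ext i : 1
    simp [h]
  refine ⟨(L.toAddEquiv.addSubgroupMap twoLambda).trans (AddEquiv.addSubgroupCongr hmap),
    fun i => Subtype.ext ?_⟩
  simp [twoVec, h]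

theorem exists_rotation :
    ∃ A : twoLambda ≃+ twoLambda, ∀ i, A (twoVec i) = twoVec (i + 1) := by
  have h3 : Real.sqrt 3 * Real.sqrt 3 = 3 := Real.mul_self_sqrt (by norm_num)
  let L : Plane ≃ₗ[ℝ] Plane :=
    { toFun := fun y => ![-y 0 / 2 - Real.sqrt 3 / 2 * y 1, Real.sqrt 3 / 2 * y 0 - y 1 / 2]
      invFun := fun y => ![-y 0 / 2 + Real.sqrt 3 / 2 * y 1, -(Real.sqrt 3 / 2 * y 0) - y 1 / 2]
      map_add' := fun x y => by ext i; fin_cases i <;> simp <;> ring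
      map_smul' := fun x y => by ext i; fin_cases i <;> simp <;> ring
      left_inv := fun y => by
        ext i
        fin_cases i <;> simp
        · linear_combination y 0 / 4 * h3
        · linear_combination y 1 / 4 * h3
      right_inv := fun y => by
        ext i
        fin_cases i <;> simp
        · linear_combination y 0 / 4 * h3
        · linear_combination y 1 / 4 * h3 }
  refine exists_addEquiv_twoLambda L (Equiv.addRight 1) fun i => ?_
  ext j
  fin_cases i <;> fin_cases j <;> simp [L, eisVec] <;> linarith

theorem exists_reflection :
    ∃ A : twoLambda ≃+ twoLambda, ∀ i, A (twoVec i) = twoVec (-i) := by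
  let L : Plane ≃ₗ[ℝ] Plane :=
    { toFun := fun y => ![y 0, -y 1]
      invFun := fun y => ![y 0, -y 1]
      map_add' := fun x y => by ext i; fin_cases i <;> simp; ring
      map_smul' := fun x y => by ext i; fin_cases i <;> simp
      left_inv := fun y => by ext i; fin_cases i <;> simp
      right_inv := fun y => by ext i; fin_cases i <;> simp }
  refine exists_addEquiv_twoLambda L (Equiv.neg _) fun i => ?_
  ext j
  fin_cases i <;> fin_cases j <;> simp [L, eisVec]

theorem twoVec_two : twoVec 2 = -twoVec 0 - twoVec 1 := by
  ext i
  fin_cases i <;> simp [twoVec, eisVec]; ring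

theorem twoVec_ne_zero (i : Fin 3) (n : ℕ) (hn : n ≠ 0) : n • twoVec i ≠ 0 := by
  intro h
  have h0 := congrFun (congrArg Subtype.val h) 0
  fin_cases i <;> simp [twoVec, eisVec, hn] at h0

/-- The permutation `(i, c) ↦ (π i, A c + d i)` of the copies of the rhombus in `S`. -/
def copyPerm (π : Equiv.Perm (Fin 3)) (A : twoLambda ≃+ twoLambda) (d : Fin 3 → twoLambda) :
    Fin 3 × twoLambda ≃ Fin 3 × twoLambda where
  toFun p := (π p.1, A p.2 + d p.1)
  invFun p := (π.symm p.1, A.symm (p.2 - d (π.symm p.1)))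
  left_inv p := by simp
  right_inv p := by simp

theorem gluingS_right (p : Fin 3 × twoLambda) :
    gluingS.right p = (p.1 + 1, p.2 + twoVec p.1) := rfl

theorem gluingS_up (p : Fin 3 × twoLambda) :
    gluingS.up p = (p.1 - 1, p.2 + twoVec p.1) := rfl

theorem gluingS_right_inv (p : Fin 3 × twoLambda) :
    gluingS.right⁻¹ p = (p.1 - 1, p.2 - twoVec (p.1 - 1)) := rfl

theorem gluingS_up_inv (p : Fin 3 × twoLambda) :
    gluingS.up⁻¹ p = (p.1 + 1, p.2 - twoVec (p.1 + 1)) := rfl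

theorem glShear_pow_mem_lifts_gluingS : glShear ^ 3 ∈ gluingS.lifts := by
  refine gluingS.glShear_pow_mem_lifts (Equiv.ext fun p => ?_)
  obtain ⟨i, c⟩ := p
  simp only [pow_three, Equiv.Perm.mul_apply, gluingS_right, Equiv.Perm.one_apply, Prod.mk.injEq]
  constructor
  · revert i; decide
  · fin_cases i <;> simp [twoVec_two]
    abel

/-- On `S` the permutation of the copies has to be `(i, c) ↦ (π i, A c + d i)` with an automorphism
`A` of `2Λ`. Here it is induced by the reflection of the plane that exchanges `v₁` and `v₂`. -/
theorem glSwap_mem_lifts_gluingS : glSwap ∈ gluingS.lifts := by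
  obtain ⟨A, hA⟩ := exists_reflection
  refine gluingS.glSwap_mem_lifts (copyPerm (Equiv.neg _) A 0) (fun p => ?_) (fun p => ?_) <;>
    simp [copyPerm, gluingS_right, gluingS_up, hA] <;> abel

theorem neg_one_mem_lifts_gluingS : -1 ∈ gluingS.lifts := by
  obtain ⟨A, hA⟩ := exists_reflection
  refine gluingS.neg_one_mem_lifts
    (copyPerm (Equiv.neg _) (A.trans (AddEquiv.neg _)) fun i => -twoVec (-i))
    (fun p => ?_) (fun p => ?_) <;>
    simp [copyPerm, gluingS_right, gluingS_up, gluingS_right_inv, gluingS_up_inv, hA] <;>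
    constructor <;> abel

theorem glDiag_mem_lifts_gluingS : glDiag ∈ gluingS.lifts := by
  obtain ⟨A, hA⟩ := exists_rotation
  -- the offsets solve `d i - d (i - 1) = -2vᵢ`, which is possible since `2v₀ + 2v₁ + 2v₂ = 0`
  refine gluingS.glDiag_mem_lifts (copyPerm 1 A ![0, -twoVec 1, twoVec 0])
    (fun p => ?_) (fun p => ?_)
  · obtain ⟨i, c⟩ := p
    fin_cases i <;> simp [copyPerm, gluingS_right, gluingS_up_inv, hA, twoVec_two] <;> abel
  · obtain ⟨i, c⟩ := p
    have h2 : twoVec (-1) = -twoVec 0 - twoVec 1 := twoVec_two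
    fin_cases i <;> simp [copyPerm, gluingS_right, gluingS_up, hA, h2, twoVec_two] <;> abel

theorem glShear_pow_mem_lifts_gluingZ : glShear ^ 3 ∈ gluingZ.lifts :=
  gluingZ.glShear_pow_mem_lifts (by decide)

theorem glSwap_mem_lifts_gluingZ : glSwap ∈ gluingZ.lifts :=
  gluingZ.glSwap_mem_lifts (Equiv.neg _) (by decide) (by decide)

theorem neg_one_mem_lifts_gluingZ : -1 ∈ gluingZ.lifts :=
  gluingZ.neg_one_mem_lifts (Equiv.neg _) (by decide) (by decide)

theorem glDiag_mem_lifts_gluingZ : glDiag ∈ gluingZ.lifts :=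
  gluingZ.glDiag_mem_lifts (Equiv.refl _) (by decide) (by decide)

/-- In `Z°`, diagonals close up after one step, and horizontal lines do not. -/
theorem mulVec_diagonal_ne_gluingZ {N : GL (Fin 2) ℤ} (hN : N ∈ gluingZ.lifts) :
    N.val.mulVec ![1, 1] ≠ ![1, 0] := by
  intro h
  have h1 : gluingZ.HasClosedLine 1 ![1, 1] :=
    (gluingZ.hasClosedLine_diagonal_iff 1).2 (by decide)
  have h2 := h1.map hN
  rw [h, Gluing.hasClosedLine_horizontal_iff] at h2
  revert h2
  decide

/-- In `S`, horizontal lines close up after three steps, and diagonals do not. -/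
theorem mulVec_diagonal_ne_gluingS {N : GL (Fin 2) ℤ} (hN : N ∈ gluingS.lifts) :
    N.val.mulVec ![1, 1] ≠ ![1, 0] := by
  intro h
  have h1 : gluingS.HasClosedLine 3 ![1, 0] := by
    refine (gluingS.hasClosedLine_horizontal_iff 3).2 ⟨(0, 0), ?_⟩
    simp [pow_three, gluingS_right, twoVec_two]
  have h2 := h1.map (inv_mem hN : N⁻¹ ∈ gluingS.lifts)
  rw [← h, Matrix.mulVec_mulVec, ← Units.val_mul, inv_mul_cancel, Units.val_one,
    Matrix.one_mulVec, Gluing.hasClosedLine_diagonal_iff] at h2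
  obtain ⟨⟨i, c⟩, hi⟩ := h2
  refine twoVec_ne_zero (i - 1) 3 (by norm_num) ?_
  have h3 : twoVec (i - 1) = -(twoVec i + twoVec (i + 1)) := by
    fin_cases i
    · exact twoVec_two.trans (by simp; abel)
    · simp [twoVec_two]
    · simp [twoVec_two]
  simp only [pow_three, Equiv.Perm.mul_apply, gluingS_right, gluingS_up, Prod.mk.injEq,
    add_sub_cancel_right] at hi
  rw [h3]
  linear_combination (norm := module) (-1 : ℤ) • hi.2

/-! ### The arithmetic of visible vectors -/

theorem mulVec_eq (N : Matrix (Fin 2) (Fin 2) ℤ) (w : Fin 2 → ℤ) :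
    N.mulVec w = ![N 0 0 * w 0 + N 0 1 * w 1, N 1 0 * w 0 + N 1 1 * w 1] := by
  ext i
  fin_cases i <;> simp [Matrix.mulVec, dotProduct, Fin.sum_univ_two]

theorem mulVec_inv_mulVec (N : GL (Fin 2) ℤ) (w : Fin 2 → ℤ) :
    N⁻¹.val.mulVec (N.val.mulVec w) = w := by
  rw [Matrix.mulVec_mulVec, ← Units.val_mul, inv_mul_cancel, Units.val_one, Matrix.one_mulVec]

theorem mem_visible_iff {w : Fin 2 → ℤ} : w ∈ visible ↔ IsCoprime (w 0) (w 1) := by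
  rw [Int.isCoprime_iff_gcd_eq_one]
  refine ⟨fun h => h.2, fun h => ⟨?_, h⟩⟩
  rintro rfl
  simp at h

theorem mulVec_mem_visible (N : GL (Fin 2) ℤ) {w : Fin 2 → ℤ} (hw : w ∈ visible) :
    N.val.mulVec w ∈ visible := by
  obtain ⟨u, v, huv⟩ := mem_visible_iff.1 hw
  have h := mulVec_inv_mulVec N w
  set z := N.val.mulVec w
  rw [mulVec_eq] at h
  have h0 := congrFun h 0
  have h1 := congrFun h 1
  simp only [Matrix.cons_val_zero, Matrix.cons_val_one] at h0 h1
  refine mem_visible_iff.2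
    ⟨u * N⁻¹.val 0 0 + v * N⁻¹.val 1 0, u * N⁻¹.val 0 1 + v * N⁻¹.val 1 1, ?_⟩
  linear_combination u * h0 + v * h1 + huv

/-- The Euclidean algorithm of the matrices `glDiag` and `glShear ^ 3`, in the coordinates `(x, y)`
for which they are `(x, y) ↦ (x, y + x)` and `(x, y) ↦ (x + 3 y, y)`. -/
theorem exists_mulVec_eq_of_isCoprime {K : Subgroup (GL (Fin 2) ℤ)} (hswap : glSwap ∈ K)
    (hneg : -1 ∈ K) (hdiag : glDiag ∈ K) (hshear : glShear ^ 3 ∈ K) (n : ℕ) :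
    ∀ x y : ℤ, x.natAbs + y.natAbs ≤ n → IsCoprime x y →
      (3 ∣ x → ∃ N ∈ K, N.val.mulVec ![x + y, y] = ![1, 1]) ∧
      (¬ 3 ∣ x → ∃ N ∈ K, N.val.mulVec ![x + y, y] = ![1, 0]) := by
  let P : ℤ → ℤ → Prop := fun x y => IsCoprime x y →
      (3 ∣ x → ∃ N ∈ K, N.val.mulVec ![x + y, y] = ![1, 1]) ∧
      (¬ 3 ∣ x → ∃ N ∈ K, N.val.mulVec ![x + y, y] = ![1, 0])
  have step : ∀ {x y x' y' a b c d : ℤ} (M : GL (Fin 2) ℤ), M ∈ K → M.val = !![a, b; c, d] →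
      a * (x + y) + b * y = x' + y' → c * (x + y) + d * y = y' →
      (IsCoprime x y → IsCoprime x' y') → (3 ∣ x ↔ 3 ∣ x') → P x' y' → P x y := by
    intro x y x' y' a b c d M hM hval e1 e2 hco h3 hP hxy
    have h : M.val.mulVec ![x + y, y] = ![x' + y', y'] := by
      rw [hval, mulVec_eq]
      simp [e1, e2]
    have key : ∀ z, (∃ N ∈ K, N.val.mulVec ![x' + y', y'] = z) →
        ∃ N ∈ K, N.val.mulVec ![x + y, y] = z := by
      rintro z ⟨N, hN, hz⟩
      exact ⟨N * M, mul_mem hN hM, by rw [Units.val_mul, ← Matrix.mulVec_mulVec, h, hz]⟩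
    rw [h3]
    exact ⟨fun h => key _ ((hP (hco hxy)).1 h), fun h => key _ ((hP (hco hxy)).2 h)⟩
  have hadd : ∀ x y, P x (y + x) → P x y := fun x y =>
    step (a := 2) (b := -1) (c := 1) (d := 0) glDiag hdiag rfl (by ring) (by ring)
      (fun h => by simpa using IsCoprime.add_mul_left_right h 1) Iff.rfl
  have hnegx : ∀ x y, P (-x) y → P x y := fun x y =>
    step (a := -1) (b := 2) (c := 0) (d := 1) (glDiag * glSwap) (mul_mem hdiag hswap)
      (by decide) (by ring) (by ring) (fun h => h.neg_left) (dvd_neg).symm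
  have hneg' : ∀ x y, P (-x) (-y) → P x y := fun x y =>
    step (a := -1) (b := 0) (c := 0) (d := -1) (-1) hneg (by decide) (by ring) (by ring)
      (fun h => h.neg_neg) (dvd_neg).symm
  have hnegy : ∀ x y, P x (-y) → P x y := fun x y h =>
    hnegx _ _ (hneg' _ _ (by rwa [neg_neg]))
  have hsub : ∀ x y, P x (y - x) → P x y := fun x y h =>
    hnegx _ _ (hadd _ _ (hnegx _ _ (by simpa [sub_eq_add_neg] using h)))
  have hadd3 : ∀ x y, P (x + 3 * y) y → P x y := fun x y =>
    step (a := 1) (b := 3) (c := 0) (d := 1) (glShear ^ 3) hshear (by decide) (by ring) (by ring)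
      (fun h => IsCoprime.add_mul_right_left h 3) (by omega)
  have hsub3 : ∀ x y, P (x - 3 * y) y → P x y := fun x y h =>
    hnegy _ _ (hadd3 _ _ (hnegy _ _ (by simpa [sub_eq_add_neg] using h)))
  have habs : ∀ x y, P |x| |y| → P x y := by
    intro x y h
    rcases abs_choice x with hx | hx <;> rcases abs_choice y with hy | hy <;> rw [hx, hy] at h
    · exact h
    · exact hnegy _ _ h
    · exact hnegx _ _ h
    · exact hnegy _ _ (hnegx _ _ h)
  change ∀ x y : ℤ, x.natAbs + y.natAbs ≤ n → P x y
  induction n with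
  | zero =>
    intro x y hn hco
    obtain ⟨rfl, rfl⟩ : x = 0 ∧ y = 0 := by omega
    exact absurd hco not_isCoprime_zero_zero
  | succ n ih =>
    intro x y hn
    refine habs x y ?_
    have hn' : |x|.natAbs + |y|.natAbs ≤ n + 1 := by rwa [Int.natAbs_abs, Int.natAbs_abs]
    have hx := abs_nonneg x
    have hy := abs_nonneg y
    generalize |x| = x at hx hn' ⊢
    generalize |y| = y at hy hn' ⊢
    rcases hx.eq_or_lt with rfl | hx
    · intro hco
      rw [isCoprime_zero_left, Int.isUnit_iff] at hco
      obtain rfl : y = 1 := by omega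
      exact ⟨fun _ => ⟨1, one_mem _, by simp⟩, fun h => absurd (dvd_zero 3) h⟩
    rcases hy.eq_or_lt with rfl | hy
    · intro hco
      rw [isCoprime_zero_right, Int.isUnit_iff] at hco
      obtain rfl : x = 1 := by omega
      exact ⟨fun h => by norm_num at h, fun _ => ⟨1, one_mem _, by simp⟩⟩
    -- for `x < 2 y` subtracting `x` makes `|y|` smaller; otherwise `3 y < 2 x`, and subtracting
    -- `3 y` makes `|x|` smaller
    by_cases h : x < 2 * y
    · exact hsub _ _ (ih _ _ (by omega))
    · exact hsub3 _ _ (ih _ _ (by omega))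

/-- The matrices that fix `(1, 1)` are the powers of `glDiag`, up to a reflection. -/
theorem mem_of_mulVec_diagonal_eq {K : Subgroup (GL (Fin 2) ℤ)} (hswap : glSwap ∈ K)
    (hdiag : glDiag ∈ K) {A : GL (Fin 2) ℤ} (hA : A.val.mulVec ![1, 1] = ![1, 1]) : A ∈ K := by
  have hpow : ∀ c : ℤ, ∀ B : GL (Fin 2) ℤ, B.val = !![1 + c, -c; c, 1 - c] → B ∈ K := by
    have hinv : (glDiag⁻¹).val = !![0, 1; -1, 2] := rfl
    have hd : glDiag.val = !![2, -1; 1, 0] := rfl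
    intro c
    induction c using Int.induction_on with
    | zero =>
      intro B hB
      have : B = 1 := Units.ext (by rw [hB, Units.val_one, Matrix.one_fin_two]; simp)
      rw [this]
      exact one_mem _
    | succ c ih =>
      intro B hB
      have := ih (glDiag⁻¹ * B) (by
        rw [Units.val_mul, hB, hinv, Matrix.mul_fin_two]
        ext i j
        fin_cases i <;> fin_cases j <;> simp <;> ring)
      simpa using mul_mem hdiag this
    | pred c ih =>
      intro B hB
      have := ih (glDiag * B) (by
        rw [Units.val_mul, hB, hd, Matrix.mul_fin_two]
        ext i j
        fin_cases i <;> fin_cases j <;> simp <;> ring)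
      simpa using mul_mem (inv_mem hdiag) this
  have key : ∀ B : GL (Fin 2) ℤ, B.val.mulVec ![1, 1] = ![1, 1] → B.val 0 0 - B.val 1 0 = 1 →
      B ∈ K := by
    intro B hB h
    rw [mulVec_eq] at hB
    have h0 := congrFun hB 0
    have h1 := congrFun hB 1
    simp only [Matrix.cons_val_zero, Matrix.cons_val_one, mul_one] at h0 h1
    refine hpow (B.val 1 0) B ?_
    ext i j
    fin_cases i <;> fin_cases j <;> simp <;> omega
  -- `A` acts by its determinant on the quotient of `ℤ²` by `(1, 1)`
  have hdet : A.val.det = A.val 0 0 - A.val 1 0 := by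
    have hA' := hA
    rw [mulVec_eq] at hA'
    have h0 := congrFun hA' 0
    have h1 := congrFun hA' 1
    simp only [Matrix.cons_val_zero, Matrix.cons_val_one, mul_one] at h0 h1
    rw [Matrix.det_fin_two]
    linear_combination A.val 0 0 * h1 - A.val 1 0 * h0
  have hunit : IsUnit A.val.det := (Matrix.isUnit_iff_isUnit_det _).1 A.isUnit
  rw [hdet, Int.isUnit_iff] at hunit
  rcases hunit with h | h
  · exact key A hA h
  · have hs : glSwap.val.mulVec ![1, 1] = ![1, 1] := by decide
    have := key (A * glSwap)
      (by rw [Units.val_mul, ← Matrix.mulVec_mulVec, hs, hA]) (by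
        rw [mulVec_eq] at hA
        have h0 := congrFun hA 0
        have h1 := congrFun hA 1
        simp only [Matrix.cons_val_zero, Matrix.cons_val_one, mul_one] at h0 h1
        simp [glSwap, Matrix.mul_apply, Fin.sum_univ_two]
        omega)
    have h2 := mul_mem this (inv_mem hswap)
    rwa [mul_inv_cancel_right] at h2

/-- A group of integral matrices that contains the four generators and does not carry `(1, 1)` to
`(1, 0)` is the stabilizer of `Ξ`; its orbits of visible vectors are `Ξ` and the complement. -/
theorem eq_stabilizer_Xi {K : Subgroup (GL (Fin 2) ℤ)} (hswap : glSwap ∈ K)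
    (hneg : -1 ∈ K) (hdiag : glDiag ∈ K) (hshear : glShear ^ 3 ∈ K)
    (hK : ∀ N ∈ K, N.val.mulVec ![1, 1] ≠ ![1, 0]) :
    (K : Set (GL (Fin 2) ℤ)) = {M | (fun w => M.val.mulVec w) '' Xi = Xi} ∧
      (∀ w ∈ Xi, ∀ w' ∈ Xi, ∃ M ∈ K, M.val.mulVec w = w') ∧
      (∀ w ∈ visible \ Xi, ∀ w' ∈ visible \ Xi, ∃ M ∈ K, M.val.mulVec w = w') := by
  have horb : ∀ w ∈ visible, (w ∈ Xi → ∃ N ∈ K, N.val.mulVec w = ![1, 1]) ∧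
      (w ∉ Xi → ∃ N ∈ K, N.val.mulVec w = ![1, 0]) := by
    intro w hw
    have hco : IsCoprime (w 0 - w 1) (w 1) := by
      simpa [sub_eq_add_neg] using
        IsCoprime.add_mul_right_left (mem_visible_iff.1 hw) (-1)
    have h := exists_mulVec_eq_of_isCoprime hswap hneg hdiag hshear _ _ _ le_rfl hco
    have hw' : ![w 0 - w 1 + w 1, w 1] = w := by ext i; fin_cases i <;> simp
    have h3 : w ∈ Xi ↔ 3 ∣ w 0 - w 1 := by
      rw [Xi, mem_ofPred_eq, Int.modEq_comm, Int.modEq_iff_dvd]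
      exact and_iff_right hw
    rwa [hw', ← h3] at h
  have htrans : ∀ {w w' z : Fin 2 → ℤ}, (∃ N ∈ K, N.val.mulVec w = z) →
      (∃ N ∈ K, N.val.mulVec w' = z) → ∃ M ∈ K, M.val.mulVec w = w' := by
    rintro w w' z ⟨N, hN, rfl⟩ ⟨N', hN', h⟩
    refine ⟨N'⁻¹ * N, mul_mem (inv_mem hN') hN, ?_⟩
    rw [Units.val_mul, ← Matrix.mulVec_mulVec, ← h, mulVec_inv_mulVec]
  have h1 : ![1, 1] ∈ Xi :=
    ⟨mem_visible_iff.2 (by simp [isCoprime_one_left]), by simp [Int.ModEq]⟩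
  have hpres : ∀ N ∈ K, ∀ w ∈ Xi, N.val.mulVec w ∈ Xi := by
    intro N hN w hw
    by_contra hn
    obtain ⟨M', hM', hMw'⟩ := (horb _ (mulVec_mem_visible N hw.1)).2 hn
    obtain ⟨A, hA, hAw⟩ := (horb w hw.1).1 hw
    refine hK (M' * N * A⁻¹) (mul_mem (mul_mem hM' hN) (inv_mem hA)) ?_
    rw [Units.val_mul, Units.val_mul, ← Matrix.mulVec_mulVec, ← hAw, mulVec_inv_mulVec,
      ← Matrix.mulVec_mulVec, hMw']
  refine ⟨?_, fun w hw w' hw' => htrans ((horb w hw.1).1 hw) ((horb w' hw'.1).1 hw'),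
    fun w hw w' hw' => htrans ((horb w hw.1).2 hw.2) ((horb w' hw'.1).2 hw'.2)⟩
  ext M
  constructor
  · intro hM
    refine Subset.antisymm (image_subset_iff.2 (hpres M hM)) fun w hw => ?_
    refine ⟨M⁻¹.val.mulVec w, hpres _ (inv_mem hM) w hw, ?_⟩
    have := mulVec_inv_mulVec M⁻¹ w
    rwa [inv_inv] at this
  · intro hM
    have hM1 : M.val.mulVec ![1, 1] ∈ Xi := by
      rw [← show (fun w => M.val.mulVec w) '' Xi = Xi from hM]
      exact mem_image_of_mem _ h1
    obtain ⟨N, hN, h⟩ := (horb _ hM1.1).1 hM1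
    have := mem_of_mulVec_diagonal_eq hswap hdiag (A := N * M)
      (by rw [Units.val_mul, ← Matrix.mulVec_mulVec, h])
    have h2 := mul_mem (inv_mem hN) this
    rwa [inv_mul_cancel_left] at h2

theorem theorem4p9 :
    (veechGroup SurfaceZ : Set (GL (Fin 2) ℝ)) =
        inBasis '' {M : GL (Fin 2) ℤ | (fun w => M.val.mulVec w) '' Xi = Xi} ∧
      (veechGroup SurfaceS : Set (GL (Fin 2) ℝ)) =
        inBasis '' {M : GL (Fin 2) ℤ | (fun w => M.val.mulVec w) '' Xi = Xi} ∧
      ∀ V ∈ ({veechGroup SurfaceZ, veechGroup SurfaceS} : Set (Subgroup (GL (Fin 2) ℝ))),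
        (∀ w ∈ Xi, ∀ w' ∈ Xi, ∃ M : GL (Fin 2) ℤ, inBasis M ∈ V ∧ M.val.mulVec w = w') ∧
        (∀ w ∈ visible \ Xi, ∀ w' ∈ visible \ Xi,
          ∃ M : GL (Fin 2) ℤ, inBasis M ∈ V ∧ M.val.mulVec w = w') := by
  obtain ⟨hZ, hZ1, hZ2⟩ := eq_stabilizer_Xi glSwap_mem_lifts_gluingZ neg_one_mem_lifts_gluingZ
    glDiag_mem_lifts_gluingZ glShear_pow_mem_lifts_gluingZ fun _ => mulVec_diagonal_ne_gluingZ
  obtain ⟨hS, hS1, hS2⟩ := eq_stabilizer_Xi glSwap_mem_lifts_gluingS neg_one_mem_lifts_gluingS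
    glDiag_mem_lifts_gluingS glShear_pow_mem_lifts_gluingS fun _ => mulVec_diagonal_ne_gluingS
  have hVZ : (veechGroup SurfaceZ : Set (GL (Fin 2) ℝ)) = inBasis '' gluingZ.lifts :=
    gluingZ.veechGroup_eq
  have hVS : (veechGroup SurfaceS : Set (GL (Fin 2) ℝ)) = inBasis '' gluingS.lifts :=
    gluingS.veechGroup_eq
  have key : ∀ (V : Subgroup (GL (Fin 2) ℝ)) (K : Subgroup (GL (Fin 2) ℤ)),
      (V : Set (GL (Fin 2) ℝ)) = inBasis '' K → ∀ w w' : Fin 2 → ℤ,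
      (∃ M ∈ K, M.val.mulVec w = w') → ∃ M : GL (Fin 2) ℤ, inBasis M ∈ V ∧ M.val.mulVec w = w' := by
    rintro V K h w w' ⟨M, hM, hMw⟩
    refine ⟨M, ?_, hMw⟩
    rw [← SetLike.mem_coe, h]
    exact mem_image_of_mem _ hM
  refine ⟨by rw [hVZ, hZ], by rw [hVS, hS], ?_⟩
  rintro V (rfl | rfl)
  · exact ⟨fun w hw w' hw' => key _ _ hVZ _ _ (hZ1 w hw w' hw'),
      fun w hw w' hw' => key _ _ hVZ _ _ (hZ2 w hw w' hw')⟩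
  · exact ⟨fun w hw w' hw' => key _ _ hVS _ _ (hS1 w hw w' hw'),
      fun w hw w' hw' => key _ _ hVS _ _ (hS2 w hw w' hw')⟩
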